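/- **Definitions.** Let $\mathbf A=56_{65}$ be the symmetric relation algebra with the four atoms $\mathrm{id},N,0,1$ whose forbidden triples of atoms are $(N,N,N)$, $(1,1,1)$, $(0,0,1)$, $(0,1,0)$, $(1,0,0)$ and $(\mathrm{id},X,Y)$, $(X,\mathrm{id},Y)$, $(X,Y,\mathrm{id})$ for atoms $X\neq Y$. (For atoms $x,y,z$ we have $z\le x\circ y$ iff $(x,y,z)$ is not forbidden.) A representation of $\mathbf A$ is a structure $\mathfrak B$ whose signature consists of the elements of $\mathbf A$ as binary relation symbols, such that $\bot^{\mathfrak B}=\varnothing$, $\top^{\mathfrak B}=\bigcup_{a}a^{\mathfrak B}$, $\mathrm{id}^{\mathfrak B}$ is equality, and complement (relative to $\top^{\mathfrak B}$), converse, join and composition of $\mathbf A$ are interpreted by complement, converse, union and composition of relations. Let $\mathbb C_3$ be the graph whose vertices are the complex numbers $z$ with $|z|=1$ and $\arg z\in\mathbb Q$, where $\arg$ takes values in $(-\pi,\pi]$, and in which $z,w$ are adjacent iff $|\arg(z/w)|>\frac23\pi$. Let $\overline{\mathbb C_3}$ be its complement. A labelling $\sigma\colon E(G)\to\mathbb Z_2$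 of a graph $G$ is *anti-even-balancing* if the labels of the edges of every triangle of $G$ add up to $0$ and those of every induced cycle of $G$ with at least $4$ vertices add up to $1$. Fix a partition $V(\mathbb C_3)=C_0\cup C_1$ into two disjoint dense sets and vertices $p^0,\dots,p^4$ on which $\overline{\mathbb C_3}$ induces a $5$-cycle with edges $p^ip^{i+1}$ (indices modulo $5$). For a vertex $x$ let $i(x)\in\{0,1\}$ be such that $x\in C_{i(x)}$, and let $p_x=p^j$ for the least $j\in\{0,\dots,4\}$ such that $xp^j\in E(\overline{\mathbb C_3})$. The edges $xp_x$ form a spanning tree of $\overline{\mathbb C_3}$, in which the edge $p^0p^1$ arises both from $x=p^0$ and from $x=p^1$, and no other edge arises twice. Fix $e\in\{i(p^0),i(p^1)\}$. **Theorem.** There is exactly one anti-even-balancing labelling $\sigma$ of $\overline{\mathbb C_3}$ such that $\sigma(p^0p^1)=e$ and $\sigma(xp_x)=i(x)$ for all vertices $x\notin\{p^0,p^1\}$. Let $\mathfrak B$ be the structure with domain $V(\mathbb C_3)$ whose signature consists of the elements of $56_{65}$, where $\mathrm{id}^{\mathfrak B}$ is equality, $N^{\mathfrak B}$ is the set of pairs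 of distinct vertices that are not adjacent in $\overline{\mathbb C_3}$, $0^{\mathfrak B}$ and $1^{\mathfrak B}$ are the sets of pairs of vertices adjacent in $\overline{\mathbb C_3}$ by an edge with $\sigma$-label $0$ and $1$ respectively, and every other element is interpreted by the union of the relations of the atoms below it. Then $\mathfrak B$ is a representation of $56_{65}$, and $\mathfrak B$ pp-constructs $K_3$; that is, $K_3$ is homomorphically equivalent to a graph structure (a set with one binary relation) with domain $B^d$, for some $d\ge 1$, whose edge relation, read as a $2d$-ary relation on $B=V(\mathbb C_3)$, is definable in $\mathfrak B$ by a primitive positive formula without parameters. -/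

import Mathlib

open FirstOrder

/-! ### Relation algebras and their representations -/

/-- A relation algebra: a Boolean algebra together with a composition, a converse operation and an
identity element. -/
class RelationAlgebra (A : Type*) extends BooleanAlgebra A where
  /-- composition -/
  rcomp : A → A → A
  /-- converse -/
  conv : A → A
  /-- the identity element -/
  ident : A
  rcomp_assoc : ∀ a b c : A, rcomp (rcomp a b) c = rcomp a (rcomp b c)
  sup_rcomp : ∀ a b c : A, rcomp (a ⊔ b) c = rcomp a c ⊔ rcomp b c
  rcomp_ident : ∀ a : A, rcomp a ident = a
  conv_conv : ∀ a : A, conv (conv a) = a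
  conv_sup : ∀ a b : A, conv (a ⊔ b) = conv a ⊔ conv b
  conv_rcomp : ∀ a b : A, conv (rcomp a b) = rcomp (conv b) (conv a)
  compl_sup_rcomp : ∀ a b : A, bᶜ ⊔ rcomp (conv a) (rcomp a b)ᶜ = bᶜ

/-- The relation symbols of the signature in which every element of `A` is a binary symbol. -/
inductive BinarySymbol (A : Type*) : ℕ → Type _
  | sym (a : A) : BinarySymbol A 2

/-- The relational signature in which every element of `A` is a binary relation symbol. -/
def binaryLanguage (A : Type*) : Language.{0} := ⟨fun _ => Empty, BinarySymbol A⟩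

/-- The binary relation by which a structure with signature `A` interprets `a : A`. -/
def interp {A B : Type*} (S : (binaryLanguage A).Structure B) (a : A) : SetRel B B :=
  {q | S.RelMap (BinarySymbol.sym a : (binaryLanguage A).Relations 2) ![q.1, q.2]}

/-- A structure with signature `A` is a representation of the relation algebra `A`. -/
structure IsRepresentation {A B : Type*} [RelationAlgebra A]
    (S : (binaryLanguage A).Structure B) : Prop where
  interp_bot : interp S ⊥ = ∅
  interp_top : interp S ⊤ = ⋃ a : A, interp S a
  interp_ident : interp S RelationAlgebra.ident = {q | q.1 = q.2}
  interp_compl : ∀ a : A, interp S aᶜ = interp S ⊤ \ interp S a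
  interp_conv : ∀ a : A, interp S (RelationAlgebra.conv a) = (interp S a).inv
  interp_sup : ∀ a b : A, interp S a ∪ interp S b = interp S (a ⊔ b)
  interp_rcomp : ∀ a b : A,
    (interp S a).comp (interp S b) = interp S (RelationAlgebra.rcomp a b)

/-! ### The relation algebra `56_65` -/

/-- The four atoms `id`, `N`, `0`, `1`. -/
inductive Atom56 : Type
  | ident | N | zero | one
  deriving DecidableEq

instance : Fintype Atom56 :=
  ⟨{.ident, .N, .zero, .one}, fun x => by cases x <;> decide⟩

namespace Atom56

/-- The forbidden triples of atoms. -/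
def Forbidden (x y z : Atom56) : Prop :=
  (x, y, z) ∈ ({(N, N, N), (one, one, one), (zero, zero, one), (zero, one, zero),
    (one, zero, zero)} : Finset (Atom56 × Atom56 × Atom56)) ∨
  ∃ X Y : Atom56, X ≠ Y ∧
    ((x, y, z) = (ident, X, Y) ∨ (x, y, z) = (X, ident, Y) ∨ (x, y, z) = (X, Y, ident))

instance (x y z : Atom56) : Decidable (Forbidden x y z) := by
  unfold Forbidden; infer_instance

theorem forbidden_rotate : ∀ x y z : Atom56, Forbidden x y z ↔ Forbidden y x z := by decide

theorem forbidden_swap : ∀ x y z : Atom56, Forbidden x y z ↔ Forbidden x z y := by decide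

theorem not_forbidden_ident : ∀ x y : Atom56, ¬ Forbidden x ident y ↔ x = y := by decide

set_option maxRecDepth 10000 in
theorem allowed_assoc : ∀ x y z t : Atom56,
    (∃ w, ¬ Forbidden x y w ∧ ¬ Forbidden w z t) ↔
      (∃ w, ¬ Forbidden y z w ∧ ¬ Forbidden x w t) := by decide

/-- Composition in `56_65`: an atom `z` lies below `a ∘ b` if and only if `(x, y, z)` is an allowed
triple for some atoms `x ≤ a` and `y ≤ b`. -/
def comp (a b : Set Atom56) : Set Atom56 :=
  {z | ∃ x ∈ a, ∃ y ∈ b, ¬ Forbidden x y z}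

end Atom56

/-- The (symmetric) relation algebra `56_65`, whose elements are the sets of atoms. -/
instance RA56 : RelationAlgebra (Set Atom56) where
  rcomp := Atom56.comp
  conv := id
  ident := {Atom56.ident}
  rcomp_assoc a b c := by
    ext t
    constructor
    · rintro ⟨w, ⟨x, hx, y, hy, hw⟩, z, hz, ht⟩
      obtain ⟨v, h₁, h₂⟩ := (Atom56.allowed_assoc x y z t).1 ⟨w, hw, ht⟩
      exact ⟨x, hx, v, ⟨y, hy, z, hz, h₁⟩, h₂⟩
    · rintro ⟨x, hx, v, ⟨y, hy, z, hz, h₁⟩, h₂⟩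
      obtain ⟨w, hw, ht⟩ := (Atom56.allowed_assoc x y z t).2 ⟨v, h₁, h₂⟩
      exact ⟨w, ⟨x, hx, y, hy, hw⟩, z, hz, ht⟩
  sup_rcomp a b c := by
    ext t
    constructor
    · rintro ⟨x, hx | hx, h⟩
      · exact Or.inl ⟨x, hx, h⟩
      · exact Or.inr ⟨x, hx, h⟩
    · rintro (⟨x, hx, h⟩ | ⟨x, hx, h⟩)
      · exact ⟨x, Or.inl hx, h⟩
      · exact ⟨x, Or.inr hx, h⟩
  rcomp_ident a := by
    ext t
    constructor
    · rintro ⟨x, hx, y, rfl, h⟩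
      exact (Atom56.not_forbidden_ident x t).1 h ▸ hx
    · intro ht
      exact ⟨t, ht, _, rfl, (Atom56.not_forbidden_ident t t).2 rfl⟩
  conv_conv a := rfl
  conv_sup a b := rfl
  conv_rcomp a b := by
    ext t
    constructor
    · rintro ⟨x, hx, y, hy, h⟩
      exact ⟨y, hy, x, hx, fun h' => h ((Atom56.forbidden_rotate x y t).2 h')⟩
    · rintro ⟨y, hy, x, hx, h⟩
      exact ⟨x, hx, y, hy, fun h' => h ((Atom56.forbidden_rotate x y t).1 h')⟩
  compl_sup_rcomp a b := by
    refine sup_eq_left.2 ?_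
    rintro t ⟨x, hx, y, hy, h⟩ ht
    exact hy ⟨x, hx, t, ht, fun h' => h ((Atom56.forbidden_swap x y t).2 h')⟩

/-! ### Signed graphs -/

/-- A labelling of a graph assigns an element of `ℤ/2` to every edge. -/
abbrev Labelling {V : Type*} (G : SimpleGraph V) : Type _ := G.edgeSet → ZMod 2

/-- A labelling is anti-even-balancing if the labels on every induced triangle add up to `0` and
those on every induced cycle with at least four vertices add up to `1`. -/
def IsAntiEvenBalancing {V : Type*} {G : SimpleGraph V} (σ : Labelling G) : Prop :=
  ∀ (n : ℕ) (_ : 3 ≤ n) (f : SimpleGraph.cycleGraph n ↪g G),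
    ∑ e : (SimpleGraph.cycleGraph n).edgeSet, σ (f.mapEdgeSet e) = if n = 3 then 0 else 1

open Classical in
/-- The atom of `56_65` that a signed graph assigns to a pair of vertices. -/
noncomputable def pairAtom {V : Type*} {G : SimpleGraph V} (σ : Labelling G) (x y : V) : Atom56 :=
  if x = y then Atom56.ident
  else if h : G.Adj x y then
    (if σ ⟨s(x, y), h⟩ = 0 then Atom56.zero else Atom56.one)
  else Atom56.N

/-- The structure with signature `56_65` defined by a signed graph `(G, σ)`: the atoms `id`, `N`,
`0`, `1` are interpreted by equality, by non-adjacency of distinct vertices and by adjacency with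
label `0` and `1` respectively, and every other element by the union of the atoms below it. -/
@[reducible]
noncomputable def signedGraphStructure {V : Type*} {G : SimpleGraph V} (σ : Labelling G) :
    (binaryLanguage (Set Atom56)).Structure V where
  funMap f := Empty.elim f
  RelMap | .sym a => fun v => pairAtom σ (v 0) (v 1) ∈ a

/-! ### The generic circular triangle-free graph -/

/-- The unit complex numbers whose argument (in `(-π, π]`) is a rational number. -/
abbrev C3Vertex : Type := {z : ℂ // ‖z‖ = 1 ∧ ∃ q : ℚ, z.arg = q}

/-- The generic circular triangle-free graph. Density of sets of vertices refers to the topology of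
the unit circle, that is, to the subspace topology of `C3Vertex`. -/
noncomputable def genericC3 : SimpleGraph C3Vertex where
  Adj z w := 2 / 3 * Real.pi < |(z.1 / w.1).arg|
  symm := ⟨fun z w h => by
    have hzw : |(w.1 / z.1).arg| = |(z.1 / w.1).arg| := by
      rw [← inv_div z.1 w.1, Complex.abs_arg_inv]
    rwa [hzw]⟩
  loopless := ⟨fun z h => by
    have hz : z.1 ≠ 0 := fun h0 => by simpa [h0] using z.2.1
    rw [div_self hz, Complex.arg_one, abs_zero] at h
    have := Real.pi_pos
    linarith⟩

/-- `p i` is the first vertex among `p 0, …, p 4` which is adjacent to `x` in the complement. -/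
def IsFirstNeighbour (p : SimpleGraph.cycleGraph 5 ↪g genericC3ᶜ) (x : C3Vertex) (i : Fin 5) :
    Prop :=
  genericC3ᶜ.Adj x (p i) ∧ ∀ j < i, ¬ genericC3ᶜ.Adj x (p j)

/-- The labelling `σ` extends the prescribed labelling of the spanning tree formed by the edges
`{x, p_x}`, where `p_x` is the first neighbour of `x` among `p 0, …, p 4`: the edge `{x, p_x}` has
label `1` if `x ∈ C₁` and `0` otherwise. The only edge that arises from two vertices is
`{p 0, p 1}`; its label is `e`. -/
def ExtendsTreeLabelling (C₁ : Set C3Vertex) (p : SimpleGraph.cycleGraph 5 ↪g genericC3ᶜ)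
    (e : ZMod 2) (σ : Labelling genericC3ᶜ) : Prop :=
  (∀ (x : C3Vertex) (i : Fin 5) (h : IsFirstNeighbour p x i), x ≠ p 0 → x ≠ p 1 →
    σ ⟨s(x, p i), h.1⟩ = C₁.indicator 1 x) ∧
  ∀ h : genericC3ᶜ.Adj (p 0) (p 1), σ ⟨s(p 0, p 1), h⟩ = e

/-! ### Primitive positive constructions -/

/-- Primitive positive formulas: built from `⊥` and atomic formulas by conjunction and existential
quantification. -/
inductive IsPrimitivePositive {L : Language} {α : Type*} :
    ∀ {n : ℕ}, L.BoundedFormula α n → Prop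
  | falsum {n : ℕ} : IsPrimitivePositive (⊥ : L.BoundedFormula α n)
  | of_isAtomic {n : ℕ} {φ : L.BoundedFormula α n} (h : φ.IsAtomic) : IsPrimitivePositive φ
  | inf {n : ℕ} {φ ψ : L.BoundedFormula α n} (h₁ : IsPrimitivePositive φ)
      (h₂ : IsPrimitivePositive ψ) : IsPrimitivePositive (φ ⊓ ψ)
  | ex {n : ℕ} {φ : L.BoundedFormula α (n + 1)} (h : IsPrimitivePositive φ) :
      IsPrimitivePositive φ.ex

/-- The structure `T` on `M ^ d` is a `d`-dimensional pp-power of the structure `S` on `M`: every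
`k`-ary relation of `T`, read as a `(k * d)`-ary relation on `M`, is defined in `S` by a primitive
positive formula without parameters. -/
def IsPPPower {L L' : Language} {M : Type*} {d : ℕ}
    (S : L.Structure M) (T : L'.Structure (Fin d → M)) : Prop :=
  ∀ (k : ℕ) (R : L'.Relations k), ∃ φ : L.Formula (Fin k × Fin d), IsPrimitivePositive φ ∧
    ∀ v : Fin k → Fin d → M, T.RelMap R v ↔ φ.Realize fun q => v q.1 q.2

/-- `S` pp-constructs the relational structure `T`: some pp-power of `S` is homomorphically
equivalent to `T`. -/
def PPConstructs {L L' : Language} [L'.IsRelational] {M N : Type*}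
    (S : L.Structure M) (T : L'.Structure N) : Prop :=
  ∃ (d : ℕ) (_ : 1 ≤ d) (P : L'.Structure (Fin d → M)), IsPPPower S P ∧
    Nonempty ((Fin d → M) →[L'] N) ∧ Nonempty (N →[L'] (Fin d → M))

/-!
Rescale the circle to circumference `3` and write `N` for adjacency in `genericC3`: two vertices are
related by `N` if their distance is greater than `1`, and adjacent in the complement if it is less.
No two vertices have distance exactly `1`, since their arguments are rational.

*Labellings.* `genericC3` has no triangles, so the induced cycles of its complement have length at
most `5`. The triangles of the complement do not wind around the circle, while its induced cycles of
length `4` and `5` wind around it exactly once. Hence the labelling `winding`, which marks the edges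
that cross a fixed point of the circle, is anti-even-balancing, and so is its sum with any
coboundary `f x + f y` (`IsPotential.isAntiEvenBalancing`). Conversely, a labelling that sums to `0`
over all induced cycles is a coboundary (`IsCycleNull.exists_potential`): two vertices related by
`N` dominate the graph, so the closed walks to be checked have length at most `5`, and these
decompose into triangles and induced cycles. The labels on a spanning tree determine the potential
`f` up to a constant, which gives existence and uniqueness (`existsUnique_labelling`).

*Representation.* Away from finitely many points, `f` differs locally by a constant from the
indicator function of `C₁`, so both of its values are dense (`exists_potential_eq_of_interval`).
Given vertices `a`, `b` and an allowed triple of atoms, a vertex `c` with the required atoms is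
found by choosing an interval for its position and then the value `f c`. If `a` and `b` are related by
`N`, their common neighbours lie on two sides, and the winding changes the sum of the labels along the
path `a c b` by `1` from one side to the other; hence all four pairs of labels occur
(`exists_pairAtom_eq_of_not_forbidden`).

*Construction of `K₃`.* Fix a vertex `p` and let a neighbour `x` of `p` stand for the label of the
edge `p x`. Since no three vertices are pairwise related by `N`, and since the labels of a triangle
add up to `0`, primitive positive formulas can express (with one-sided guarantees) the clause
"one of three labels is `1`" (`IsColourTuple`) and the clause "not both labels are `1`"
(`AreSeparated`). Triples of labels satisfying the first clause, with an edge between two triples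
if they satisfy the second clause in each place, form a graph that is coloured by the place of the
first `1` (`exists_colouring`). A triangle in it can be built from five vertices
(`exists_triangle`).
-/

/-! ### A coordinate on the circle -/

/-- The position of a vertex on the unit circle, rescaled so that the circle has circumference `3`;
it takes values in `(-3/2, 3/2)`. -/
noncomputable def circleCoord (x : C3Vertex) : ℝ := x.1.arg * (3 / (2 * Real.pi))

theorem C3Vertex.ne_zero (x : C3Vertex) : x.1 ≠ 0 := fun h => by simpa [h] using x.2.1

theorem C3Vertex.eq_cos_add_sin (x : C3Vertex) :
    x.1 = Complex.cos (x.1.arg : ℝ) + Complex.sin (x.1.arg : ℝ) * Complex.I := by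
  have h := Complex.norm_mul_exp_arg_mul_I x.1
  rw [x.2.1, Complex.ofReal_one, one_mul, Complex.exp_mul_I] at h
  exact h.symm

theorem C3Vertex.div_eq (x y : C3Vertex) (k : ℤ) :
    x.1 / y.1 = Complex.cos ((x.1.arg - y.1.arg + k * (2 * Real.pi) : ℝ)) +
      Complex.sin ((x.1.arg - y.1.arg + k * (2 * Real.pi) : ℝ)) * Complex.I := by
  have hx := Complex.norm_mul_exp_arg_mul_I x.1
  have hy := Complex.norm_mul_exp_arg_mul_I y.1
  rw [x.2.1, Complex.ofReal_one, one_mul] at hx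
  rw [y.2.1, Complex.ofReal_one, one_mul] at hy
  rw [← Complex.exp_mul_I, ← hx, ← hy, ← Complex.exp_sub, hx, hy, Complex.exp_eq_exp_iff_exists_int]
  refine ⟨-k, ?_⟩
  push_cast
  ring

/-- The circumference is irrational in units in which the arguments of the vertices are rational,
so the argument `π` does not occur. -/
theorem C3Vertex.arg_lt_pi (x : C3Vertex) : x.1.arg < Real.pi := by
  refine lt_of_le_of_ne (Complex.arg_le_pi _) fun h => ?_
  obtain ⟨q, hq⟩ := x.2.2
  exact irrational_pi ⟨q, by rw [← hq, h]⟩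

theorem abs_arg_div_of_le {x y : C3Vertex} (h : |x.1.arg - y.1.arg| ≤ Real.pi) :
    |(x.1 / y.1).arg| = |x.1.arg - y.1.arg| := by
  have hpi := Real.pi_pos
  rcases (abs_le.1 h).1.lt_or_eq with h' | h'
  · rw [C3Vertex.div_eq x y 0, Complex.arg_cos_add_sin_mul_I]
    · simp
    · rw [Int.cast_zero, zero_mul, add_zero]; exact ⟨h', (abs_le.1 h).2⟩
  · rw [C3Vertex.div_eq x y 1, Complex.arg_cos_add_sin_mul_I, ← h']
    · rw [abs_neg]; congr 1; push_cast; ring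
    · rw [← h']; push_cast; constructor <;> linarith

theorem abs_arg_div_of_gt {x y : C3Vertex} (h : Real.pi < |x.1.arg - y.1.arg|) :
    |(x.1 / y.1).arg| = 2 * Real.pi - |x.1.arg - y.1.arg| := by
  have hpi := Real.pi_pos
  have hx := x.arg_lt_pi
  have hy := y.arg_lt_pi
  have hx' := Complex.neg_pi_lt_arg x.1
  have hy' := Complex.neg_pi_lt_arg y.1
  rcases lt_abs.1 h with h | h
  · rw [C3Vertex.div_eq x y (-1), Complex.arg_cos_add_sin_mul_I]
    · rw [abs_of_nonpos (by push_cast; linarith), abs_of_pos (by linarith)]; push_cast; ring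
    · push_cast; constructor <;> linarith
  · rw [C3Vertex.div_eq x y 1, Complex.arg_cos_add_sin_mul_I]
    · rw [abs_of_nonneg (by push_cast; linarith), abs_of_neg (by linarith)]; push_cast; ring
    · push_cast; constructor <;> linarith

theorem circleCoord_sub (x y : C3Vertex) :
    |x.1.arg - y.1.arg| = |circleCoord x - circleCoord y| * (2 * Real.pi / 3) := by
  have hpi := Real.pi_pos
  have : x.1.arg - y.1.arg = (circleCoord x - circleCoord y) * (2 * Real.pi / 3) := by
    unfold circleCoord; field_simp
  rw [this, abs_mul, abs_of_pos (by positivity : (0 : ℝ) < 2 * Real.pi / 3)]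

theorem abs_circleCoord_lt (x : C3Vertex) : |circleCoord x| < 3 / 2 := by
  have hpi := Real.pi_pos
  have h : x.1.arg = circleCoord x * (2 * Real.pi / 3) := by
    unfold circleCoord; field_simp
  have h1 := x.arg_lt_pi
  have h2 := Complex.neg_pi_lt_arg x.1
  rw [abs_lt]
  constructor <;> nlinarith

theorem circleCoord_injective : Function.Injective circleCoord := by
  intro x y h
  have hpi := Real.pi_pos
  have : x.1.arg = y.1.arg := by
    have h' := circleCoord_sub x y
    rw [h, sub_self, abs_zero, zero_mul, abs_eq_zero] at h'
    linarith
  apply Subtype.ext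
  rw [x.eq_cos_add_sin, this, ← y.eq_cos_add_sin]

/-- Differences of arguments are rational, hence not in `ℤ * 2π/3` except for `0`. -/
theorem abs_circleCoord_sub_ne (x y : C3Vertex) {n : ℕ} (hn : n ≠ 0) :
    |circleCoord x - circleCoord y| ≠ n := by
  intro h
  have hxy := circleCoord_sub x y
  obtain ⟨q, hq⟩ := x.2.2
  obtain ⟨r, hr⟩ := y.2.2
  rw [h, hq, hr] at hxy
  have hn' : (n : ℝ) ≠ 0 := Nat.cast_ne_zero.2 hn
  refine irrational_pi ⟨|q - r| * 3 / (2 * n), ?_⟩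
  push_cast
  rw [hxy]
  field_simp

theorem genericC3_adj_iff {x y : C3Vertex} : genericC3.Adj x y ↔
    1 < |circleCoord x - circleCoord y| ∧ |circleCoord x - circleCoord y| < 2 := by
  have hpi := Real.pi_pos
  change 2 / 3 * Real.pi < |(x.1 / y.1).arg| ↔ _
  rcases le_or_gt |x.1.arg - y.1.arg| Real.pi with h | h
  · rw [abs_arg_div_of_le h]
    rw [circleCoord_sub] at h ⊢
    constructor
    · exact fun h' => ⟨by nlinarith, by nlinarith⟩
    · exact fun h' => by nlinarith
  · rw [abs_arg_div_of_gt h]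
    rw [circleCoord_sub] at h ⊢
    constructor
    · exact fun h' => ⟨by nlinarith, by nlinarith⟩
    · exact fun h' => by nlinarith

theorem not_genericC3_adj_iff {x y : C3Vertex} : ¬ genericC3.Adj x y ↔
    |circleCoord x - circleCoord y| < 1 ∨ 2 < |circleCoord x - circleCoord y| := by
  have h1 := abs_circleCoord_sub_ne x y one_ne_zero
  have h2 := abs_circleCoord_sub_ne x y two_ne_zero
  push_cast at h1 h2
  rw [genericC3_adj_iff]
  constructor
  · intro h
    by_contra! h'
    exact h ⟨lt_of_le_of_ne h'.1 h1.symm, lt_of_le_of_ne h'.2 h2⟩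
  · rintro (h | h) h' <;> linarith [h'.1, h'.2]

/-- Whether the short arc between two vertices passes through the point `-1` of the unit circle, at
which the coordinate jumps. On closed walks in the complement of `genericC3`, the sum of these
values is the parity of the winding number. -/
noncomputable def winding (x y : C3Vertex) : ZMod 2 :=
  if 2 < |circleCoord x - circleCoord y| then 1 else 0

theorem winding_comm (x y : C3Vertex) : winding x y = winding y x := by
  unfold winding; rw [abs_sub_comm]

theorem abs_circleCoord_sub_lt (x y : C3Vertex) : |circleCoord y - circleCoord x| < 3 := by
  have hx := abs_lt.1 (abs_circleCoord_lt x)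
  have hy := abs_lt.1 (abs_circleCoord_lt y)
  exact abs_lt.2 ⟨by linarith, by linarith⟩

theorem eq_of_abs_add_three_mul_lt {d : ℝ} (hd : |d| < 3) {k : ℤ} (h : |d + 3 * k| < 3) :
    k = -1 ∨ k = 0 ∨ k = 1 := by
  rw [abs_lt] at hd h
  have h1 : (-2 : ℝ) < k := by linarith
  have h2 : (k : ℝ) < 2 := by linarith
  have h1' : -2 < k := by exact_mod_cast h1
  have h2' : k < 2 := by exact_mod_cast h2
  omega

theorem genericC3_adj_of_lift {x y : C3Vertex} (k : ℤ)
    (h₁ : 1 < circleCoord y - circleCoord x + 3 * k)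
    (h₂ : circleCoord y - circleCoord x + 3 * k < 2) : genericC3.Adj x y := by
  have hd := abs_circleCoord_sub_lt x y
  rw [genericC3_adj_iff, abs_sub_comm]
  rcases eq_of_abs_add_three_mul_lt hd (abs_lt.2 ⟨by linarith, by linarith⟩) with
    rfl | rfl | rfl <;> push_cast at h₁ h₂ <;> rw [abs_lt] at hd ⊢ <;> rw [lt_abs]
  · linarith
  · exact ⟨Or.inl (by linarith), by linarith, by linarith⟩
  · exact ⟨Or.inr (by linarith), by linarith, by linarith⟩

theorem exists_lift_of_genericC3_adj {x y : C3Vertex} (h : genericC3.Adj x y) :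
    ∃ k : ℤ, 1 < circleCoord y - circleCoord x + 3 * k ∧
      circleCoord y - circleCoord x + 3 * k < 2 := by
  rw [genericC3_adj_iff, abs_sub_comm, lt_abs, abs_lt] at h
  rcases h with ⟨h | h, h1, h2⟩
  · exact ⟨0, by push_cast; linarith, by push_cast; linarith⟩
  · exact ⟨1, by push_cast; linarith, by push_cast; linarith⟩

theorem not_genericC3_adj_of_lift {x y : C3Vertex} (k : ℤ)
    (h : |circleCoord y - circleCoord x + 3 * k| < 1) :
    ¬ genericC3.Adj x y ∧ winding x y = k := by
  have hd := abs_circleCoord_sub_lt x y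
  have key : (|circleCoord x - circleCoord y| < 1 ∧ k = 0) ∨
      (2 < |circleCoord x - circleCoord y| ∧ (k = -1 ∨ k = 1)) := by
    have hd' := abs_lt.1 hd
    rw [abs_lt] at h
    rw [abs_sub_comm]
    rcases eq_of_abs_add_three_mul_lt hd (abs_lt.2 ⟨by linarith, by linarith⟩) with
      rfl | rfl | rfl <;> push_cast at h
    · exact Or.inr ⟨lt_abs.2 (Or.inl (by linarith)), Or.inl rfl⟩
    · exact Or.inl ⟨abs_lt.2 ⟨by linarith, by linarith⟩, rfl⟩
    · exact Or.inr ⟨lt_abs.2 (Or.inr (by linarith)), Or.inr rfl⟩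
  refine ⟨not_genericC3_adj_iff.2 (key.imp And.left And.left), ?_⟩
  unfold winding
  rcases key with ⟨h', rfl⟩ | ⟨h', rfl | rfl⟩
  · rw [if_neg (by linarith)]; rfl
  · rw [if_pos h']; rfl
  · rw [if_pos h']; rfl

theorem exists_lift_of_not_genericC3_adj {x y : C3Vertex} (h : ¬ genericC3.Adj x y) :
    ∃ k : ℤ, |circleCoord y - circleCoord x + 3 * k| < 1 := by
  have hd := abs_lt.1 (abs_circleCoord_sub_lt x y)
  rw [not_genericC3_adj_iff, abs_sub_comm, lt_abs] at h
  rcases h with h | h | h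
  · exact ⟨0, by simpa using h⟩
  · exact ⟨-1, abs_lt.2 ⟨by push_cast; linarith, by push_cast; linarith⟩⟩
  · exact ⟨1, abs_lt.2 ⟨by push_cast; linarith, by push_cast; linarith⟩⟩

theorem genericC3_triangle_free {x y z : C3Vertex} (hxy : genericC3.Adj x y)
    (hyz : genericC3.Adj y z) : ¬ genericC3.Adj x z := by
  intro hzx
  obtain ⟨k, hk⟩ := exists_lift_of_genericC3_adj hxy
  obtain ⟨l, hl⟩ := exists_lift_of_genericC3_adj hyz
  obtain ⟨m, hm⟩ := exists_lift_of_genericC3_adj hzx.symm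
  have h1 : (1 : ℝ) < ((k + l + m : ℤ) : ℝ) := by push_cast; linarith
  have h2 : ((k + l + m : ℤ) : ℝ) < 2 := by push_cast; linarith
  have h1' : 1 < k + l + m := by exact_mod_cast h1
  have h2' : k + l + m < 2 := by exact_mod_cast h2
  omega

theorem winding_triangle {x y z : C3Vertex} (hxy : ¬ genericC3.Adj x y)
    (hyz : ¬ genericC3.Adj y z) (hxz : ¬ genericC3.Adj x z) :
    winding x y + winding y z = winding x z := by
  obtain ⟨k, hk⟩ := exists_lift_of_not_genericC3_adj hxy
  obtain ⟨l, hl⟩ := exists_lift_of_not_genericC3_adj hyz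
  obtain ⟨m, hm⟩ := exists_lift_of_not_genericC3_adj hxz
  rw [(not_genericC3_adj_of_lift k hk).2, (not_genericC3_adj_of_lift l hl).2,
    (not_genericC3_adj_of_lift m hm).2]
  rw [abs_lt] at hk hl hm
  have h1 : (-1 : ℝ) < ((k + l - m : ℤ) : ℝ) := by push_cast; linarith
  have h2 : ((k + l - m : ℤ) : ℝ) < 1 := by push_cast; linarith
  have h1' : -1 < k + l - m := by exact_mod_cast h1
  have h2' : k + l - m < 1 := by exact_mod_cast h2
  obtain rfl : m = k + l := by omega
  push_cast
  rfl

/-- The displacement `d` from `x` to `y` along the short arc, together with the number `k` of turns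
by which it differs from the difference of the coordinates. -/
theorem exists_displacement {x y : C3Vertex} (h : ¬ genericC3.Adj x y) :
    ∃ (k : ℤ) (d : ℝ), circleCoord y - circleCoord x + 3 * k = d ∧ -1 < d ∧ d < 1 ∧
      winding x y = k := by
  obtain ⟨k, hk⟩ := exists_lift_of_not_genericC3_adj h
  exact ⟨k, _, rfl, (abs_lt.1 hk).1, (abs_lt.1 hk).2, (not_genericC3_adj_of_lift k hk).2⟩

/-- Two consecutive steps of an induced cycle go in the same direction. -/
theorem displacement_add {x y z : C3Vertex} {k l : ℤ} {d d' : ℝ} (h : genericC3.Adj x z)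
    (hd : circleCoord y - circleCoord x + 3 * k = d)
    (hd' : circleCoord z - circleCoord y + 3 * l = d') : 1 < d + d' ∨ d + d' < -1 := by
  by_contra! h'
  obtain ⟨m, hm⟩ := exists_lift_of_genericC3_adj h
  have h1 : (0 : ℝ) < ((m - k - l : ℤ) : ℝ) := by push_cast; linarith
  have h2 : ((m - k - l : ℤ) : ℝ) < 1 := by push_cast; linarith
  have h1' : 0 < m - k - l := by exact_mod_cast h1
  have h2' : m - k - l < 1 := by exact_mod_cast h2
  omega

theorem winding_sum_eq_one_of_eq {k : ℤ} {d : ℝ} (h : 3 * (k : ℝ) = d)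
    (hd : (2 < d ∧ d < 5) ∨ (d < -2 ∧ -5 < d)) : (k : ZMod 2) = 1 := by
  have hk : k = 1 ∨ k = -1 := by
    rcases hd with ⟨h1, h2⟩ | ⟨h1, h2⟩
    · have h1 : (0 : ℝ) < k := by linarith
      have h2 : (k : ℝ) < 2 := by linarith
      have h1' : 0 < k := by exact_mod_cast h1
      have h2' : k < 2 := by exact_mod_cast h2
      omega
    · have h1 : (k : ℝ) < 0 := by linarith
      have h2 : (-2 : ℝ) < k := by linarith
      have h1' : k < 0 := by exact_mod_cast h1
      have h2' : -2 < k := by exact_mod_cast h2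
      omega
  rcases hk with rfl | rfl <;> rfl

/-- All steps of an induced cycle go in the same direction, and any two consecutive ones add up to
more than `1`; hence the cycle has total displacement `3` or `-3`, that is, it winds around the
circle once. -/
theorem winding_quadrilateral {a b c d : C3Vertex} (hab : ¬ genericC3.Adj a b)
    (hbc : ¬ genericC3.Adj b c) (hcd : ¬ genericC3.Adj c d) (hda : ¬ genericC3.Adj d a)
    (hac : genericC3.Adj a c) (hbd : genericC3.Adj b d) :
    winding a b + winding b c + winding c d + winding d a = 1 := by
  obtain ⟨k₁, d₁, e₁, l₁, u₁, w₁⟩ := exists_displacement hab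
  obtain ⟨k₂, d₂, e₂, l₂, u₂, w₂⟩ := exists_displacement hbc
  obtain ⟨k₃, d₃, e₃, l₃, u₃, w₃⟩ := exists_displacement hcd
  obtain ⟨k₄, d₄, e₄, l₄, u₄, w₄⟩ := exists_displacement hda
  have s₁ := displacement_add hac e₁ e₂
  have s₂ := displacement_add hbd e₂ e₃
  have s₃ := displacement_add hac.symm e₃ e₄
  rw [w₁, w₂, w₃, w₄]
  have := winding_sum_eq_one_of_eq (k := k₁ + k₂ + k₃ + k₄) (d := d₁ + d₂ + d₃ + d₄)
    (by push_cast; linarith) (by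
      rcases s₁ with s₁ | s₁
      · have s₂ := s₂.resolve_right (by linarith)
        have s₃ := s₃.resolve_right (by linarith)
        exact Or.inl ⟨by linarith, by linarith⟩
      · have s₂ := s₂.resolve_left (by linarith)
        have s₃ := s₃.resolve_left (by linarith)
        exact Or.inr ⟨by linarith, by linarith⟩)
  exact_mod_cast this

theorem winding_pentagon {a b c d e : C3Vertex} (hab : ¬ genericC3.Adj a b)
    (hbc : ¬ genericC3.Adj b c) (hcd : ¬ genericC3.Adj c d) (hde : ¬ genericC3.Adj d e)
    (hea : ¬ genericC3.Adj e a) (hac : genericC3.Adj a c) (hbd : genericC3.Adj b d)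
    (hce : genericC3.Adj c e) (hda : genericC3.Adj d a) :
    winding a b + winding b c + winding c d + winding d e + winding e a = 1 := by
  obtain ⟨k₁, d₁, e₁, l₁, u₁, w₁⟩ := exists_displacement hab
  obtain ⟨k₂, d₂, e₂, l₂, u₂, w₂⟩ := exists_displacement hbc
  obtain ⟨k₃, d₃, e₃, l₃, u₃, w₃⟩ := exists_displacement hcd
  obtain ⟨k₄, d₄, e₄, l₄, u₄, w₄⟩ := exists_displacement hde
  obtain ⟨k₅, d₅, e₅, l₅, u₅, w₅⟩ := exists_displacement hea
  have s₁ := displacement_add hac e₁ e₂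
  have s₂ := displacement_add hbd e₂ e₃
  have s₃ := displacement_add hce e₃ e₄
  have s₄ := displacement_add hda e₄ e₅
  rw [w₁, w₂, w₃, w₄, w₅]
  have := winding_sum_eq_one_of_eq (k := k₁ + k₂ + k₃ + k₄ + k₅) (d := d₁ + d₂ + d₃ + d₄ + d₅)
    (by push_cast; linarith) (by
      rcases s₁ with s₁ | s₁
      · have s₂ := s₂.resolve_right (by linarith)
        have s₃ := s₃.resolve_right (by linarith)
        have s₄ := s₄.resolve_right (by linarith)
        exact Or.inl ⟨by linarith, by linarith⟩
      · have s₂ := s₂.resolve_left (by linarith)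
        have s₃ := s₃.resolve_left (by linarith)
        have s₄ := s₄.resolve_left (by linarith)
        exact Or.inr ⟨by linarith, by linarith⟩)
  exact_mod_cast this

/-! ### Labels of cycles -/

/-- The label of the pair `x, y`, extended by `0` to pairs that are not edges. -/
noncomputable def edgeLabel {V : Type*} {G : SimpleGraph V} (σ : Labelling G) (x y : V) : ZMod 2 :=
  open Classical in if h : s(x, y) ∈ G.edgeSet then σ ⟨s(x, y), h⟩ else 0

section Combinatorics

variable {V : Type*} {G H : SimpleGraph V}

theorem edgeLabel_of_adj (σ : Labelling G) {x y : V} (h : G.Adj x y) :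
    edgeLabel σ x y = σ ⟨s(x, y), h⟩ := dif_pos h

theorem edgeLabel_comm (σ : Labelling G) (x y : V) : edgeLabel σ x y = edgeLabel σ y x := by
  unfold edgeLabel
  rw [Sym2.eq_swap]

theorem edgeLabel_self (σ : Labelling G) (x : V) : edgeLabel σ x x = 0 :=
  dif_neg fun h => G.loopless.irrefl x h

theorem sum_cycleGraph_three (σ : Labelling G) (f : SimpleGraph.cycleGraph 3 ↪g G) :
    ∑ e : (SimpleGraph.cycleGraph 3).edgeSet, σ (f.mapEdgeSet e) =
      edgeLabel σ (f 0) (f 1) + edgeLabel σ (f 1) (f 2) + edgeLabel σ (f 2) (f 0) := by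
  have h : (Finset.univ : Finset (SimpleGraph.cycleGraph 3).edgeSet) =
      {⟨s(0, 1), by decide⟩, ⟨s(1, 2), by decide⟩, ⟨s(2, 0), by decide⟩} := by decide
  rw [h, Finset.sum_insert (by decide), Finset.sum_insert (by decide), Finset.sum_singleton,
    edgeLabel_of_adj σ (f.map_adj_iff.2 (by decide)),
    edgeLabel_of_adj σ (f.map_adj_iff.2 (by decide)),
    edgeLabel_of_adj σ (f.map_adj_iff.2 (by decide)), add_assoc]
  rfl

theorem sum_cycleGraph_four (σ : Labelling G) (f : SimpleGraph.cycleGraph 4 ↪g G) :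
    ∑ e : (SimpleGraph.cycleGraph 4).edgeSet, σ (f.mapEdgeSet e) =
      edgeLabel σ (f 0) (f 1) + edgeLabel σ (f 1) (f 2) + edgeLabel σ (f 2) (f 3) +
        edgeLabel σ (f 3) (f 0) := by
  have h : (Finset.univ : Finset (SimpleGraph.cycleGraph 4).edgeSet) =
      {⟨s(0, 1), by decide⟩, ⟨s(1, 2), by decide⟩, ⟨s(2, 3), by decide⟩,
        ⟨s(3, 0), by decide⟩} := by decide
  rw [h, Finset.sum_insert (by decide), Finset.sum_insert (by decide),
    Finset.sum_insert (by decide), Finset.sum_singleton,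
    edgeLabel_of_adj σ (f.map_adj_iff.2 (by decide)),
    edgeLabel_of_adj σ (f.map_adj_iff.2 (by decide)),
    edgeLabel_of_adj σ (f.map_adj_iff.2 (by decide)),
    edgeLabel_of_adj σ (f.map_adj_iff.2 (by decide)), add_assoc, add_assoc]
  rfl

theorem sum_cycleGraph_five (σ : Labelling G) (f : SimpleGraph.cycleGraph 5 ↪g G) :
    ∑ e : (SimpleGraph.cycleGraph 5).edgeSet, σ (f.mapEdgeSet e) =
      edgeLabel σ (f 0) (f 1) + edgeLabel σ (f 1) (f 2) + edgeLabel σ (f 2) (f 3) +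
        edgeLabel σ (f 3) (f 4) + edgeLabel σ (f 4) (f 0) := by
  have h : (Finset.univ : Finset (SimpleGraph.cycleGraph 5).edgeSet) =
      {⟨s(0, 1), by decide⟩, ⟨s(1, 2), by decide⟩, ⟨s(2, 3), by decide⟩,
        ⟨s(3, 4), by decide⟩, ⟨s(4, 0), by decide⟩} := by decide
  rw [h, Finset.sum_insert (by decide), Finset.sum_insert (by decide),
    Finset.sum_insert (by decide), Finset.sum_insert (by decide), Finset.sum_singleton,
    edgeLabel_of_adj σ (f.map_adj_iff.2 (by decide)),
    edgeLabel_of_adj σ (f.map_adj_iff.2 (by decide)),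
    edgeLabel_of_adj σ (f.map_adj_iff.2 (by decide)),
    edgeLabel_of_adj σ (f.map_adj_iff.2 (by decide)),
    edgeLabel_of_adj σ (f.map_adj_iff.2 (by decide)), add_assoc, add_assoc, add_assoc]
  rfl

theorem compl_adj_of_not_adj {x y : V} (hne : x ≠ y) (h : ¬ H.Adj x y) : Hᶜ.Adj x y :=
  (H.compl_adj x y).2 ⟨hne, h⟩

theorem not_adj_iff_eq_or_compl_adj {x y : V} : ¬ H.Adj x y ↔ x = y ∨ Hᶜ.Adj x y := by
  rw [H.compl_adj]
  by_cases h : x = y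
  · subst h; simp
  · simp [h]

/-- A map from a cycle is an induced embedding into `Hᶜ` if it sends distinct vertices of the cycle
to adjacent vertices of `H` or of `Hᶜ` as appropriate. -/
def cycleEmbedding {n : ℕ} (f : Fin n → V)
    (h : ∀ i j, i ≠ j → if (SimpleGraph.cycleGraph n).Adj i j then Hᶜ.Adj (f i) (f j)
      else H.Adj (f i) (f j)) : SimpleGraph.cycleGraph n ↪g Hᶜ where
  toFun := f
  inj' i j hij := by
    by_contra hne
    have := h i j hne
    split_ifs at this
    · exact this.ne hij
    · exact this.ne hij
  map_rel_iff' {i j} := by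
    by_cases hij : i = j
    · subst hij; simp
    · have := h i j hij
      split_ifs at this with hc
      · exact iff_of_true this hc
      · exact iff_of_false (fun h' => ((H.compl_adj _ _).1 h').2 this) hc

theorem IsAntiEvenBalancing.triangle {σ : Labelling Hᶜ} (hσ : IsAntiEvenBalancing σ) {a b c : V}
    (hab : Hᶜ.Adj a b) (hbc : Hᶜ.Adj b c) (hca : Hᶜ.Adj c a) :
    edgeLabel σ a b + edgeLabel σ b c + edgeLabel σ c a = 0 := by
  have h := hσ 3 le_rfl (cycleEmbedding (H := H) ![a, b, c] (by
    intro i j hij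
    fin_cases i <;> fin_cases j <;>
      first
      | exact absurd rfl hij
      | (rw [if_pos (by decide)]; first | assumption | (apply SimpleGraph.Adj.symm; assumption))))
  rw [sum_cycleGraph_three] at h
  exact h

theorem IsAntiEvenBalancing.quadrilateral {σ : Labelling Hᶜ} (hσ : IsAntiEvenBalancing σ)
    {a b c d : V} (hab : Hᶜ.Adj a b) (hbc : Hᶜ.Adj b c) (hcd : Hᶜ.Adj c d) (hda : Hᶜ.Adj d a)
    (hac : H.Adj a c) (hbd : H.Adj b d) :
    edgeLabel σ a b + edgeLabel σ b c + edgeLabel σ c d + edgeLabel σ d a = 1 := by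
  have h := hσ 4 (by norm_num) (cycleEmbedding (H := H) ![a, b, c, d] (by
    intro i j hij
    fin_cases i <;> fin_cases j <;>
      first
      | exact absurd rfl hij
      | (rw [if_pos (by decide)]; first | assumption | (apply SimpleGraph.Adj.symm; assumption))
      | (rw [if_neg (by decide)]; first | assumption | (apply SimpleGraph.Adj.symm; assumption))))
  rw [sum_cycleGraph_four] at h
  exact h

theorem IsAntiEvenBalancing.pentagon {σ : Labelling Hᶜ} (hσ : IsAntiEvenBalancing σ)
    {a b c d e : V} (hab : Hᶜ.Adj a b) (hbc : Hᶜ.Adj b c) (hcd : Hᶜ.Adj c d) (hde : Hᶜ.Adj d e)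
    (hea : Hᶜ.Adj e a) (hac : H.Adj a c) (hbd : H.Adj b d) (hce : H.Adj c e) (hda : H.Adj d a)
    (heb : H.Adj e b) :
    edgeLabel σ a b + edgeLabel σ b c + edgeLabel σ c d + edgeLabel σ d e +
      edgeLabel σ e a = 1 := by
  have h := hσ 5 (by norm_num) (cycleEmbedding (H := H) ![a, b, c, d, e] (by
    intro i j hij
    fin_cases i <;> fin_cases j <;>
      first
      | exact absurd rfl hij
      | (rw [if_pos (by decide)]; first | assumption | (apply SimpleGraph.Adj.symm; assumption))
      | (rw [if_neg (by decide)]; first | assumption | (apply SimpleGraph.Adj.symm; assumption))))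
  rw [sum_cycleGraph_five] at h
  exact h

theorem adj_of_not_cycleGraph_adj {n : ℕ} (f : SimpleGraph.cycleGraph n ↪g Hᶜ) {i j : Fin n}
    (hij : i ≠ j) (h : ¬ (SimpleGraph.cycleGraph n).Adj i j) : H.Adj (f i) (f j) := by
  rw [← f.map_adj_iff, H.compl_adj] at h
  by_contra h'
  exact h ⟨f.injective.ne hij, h'⟩

theorem cycleGraph_adj_val {n : ℕ} {i j : Fin n} (h : (SimpleGraph.cycleGraph n).Adj i j) :
    i.val + 1 = j.val ∨ j.val + 1 = i.val ∨ i.val + n = j.val + 1 ∨ j.val + n = i.val + 1 := by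
  have hi := i.isLt
  have hj := j.isLt
  rw [SimpleGraph.cycleGraph_adj', Fin.sub_def, Fin.sub_def] at h
  simp only at h
  rcases h with h | h
  · rcases le_or_gt n (n - j.val + i.val) with h' | h'
    · rw [Nat.mod_eq_sub_mod h', Nat.mod_eq_of_lt (by omega)] at h; omega
    · rw [Nat.mod_eq_of_lt h'] at h; omega
  · rcases le_or_gt n (n - i.val + j.val) with h' | h'
    · rw [Nat.mod_eq_sub_mod h', Nat.mod_eq_of_lt (by omega)] at h; omega
    · rw [Nat.mod_eq_of_lt h'] at h; omega

/-- In an induced cycle of `Hᶜ` with at least six vertices, the vertices `0, 2, 4` would form a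
triangle of `H`. -/
theorem cycle_length_lt_six (hH : ∀ ⦃x y z : V⦄, H.Adj x y → H.Adj y z → ¬ H.Adj x z) {n : ℕ}
    (f : SimpleGraph.cycleGraph n ↪g Hᶜ) : n < 6 := by
  by_contra! hn
  have key : ∀ a b : ℕ, ∀ (ha : a < n) (hb : b < n), a + 2 ≤ b → b ≤ 4 →
      H.Adj (f ⟨a, ha⟩) (f ⟨b, hb⟩) := by
    intro a b ha hb h1 h2
    refine adj_of_not_cycleGraph_adj f (fun h => ?_) fun h => ?_
    · rw [Fin.mk.injEq] at h; omega
    · have := cycleGraph_adj_val h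
      simp only at this
      omega
  exact hH (key 0 2 (by omega) (by omega) (by omega) (by omega))
    (key 2 4 (by omega) (by omega) (by omega) (by omega))
    (key 0 4 (by omega) (by omega) (by omega) (by omega))

theorem isAntiEvenBalancing_of_cycles
    (hH : ∀ ⦃x y z : V⦄, H.Adj x y → H.Adj y z → ¬ H.Adj x z) {σ : Labelling Hᶜ}
    (h₃ : ∀ a b c, Hᶜ.Adj a b → Hᶜ.Adj b c → Hᶜ.Adj c a →
      edgeLabel σ a b + edgeLabel σ b c + edgeLabel σ c a = 0)
    (h₄ : ∀ a b c d, Hᶜ.Adj a b → Hᶜ.Adj b c → Hᶜ.Adj c d → Hᶜ.Adj d a → H.Adj a c → H.Adj b d →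
      edgeLabel σ a b + edgeLabel σ b c + edgeLabel σ c d + edgeLabel σ d a = 1)
    (h₅ : ∀ a b c d e, Hᶜ.Adj a b → Hᶜ.Adj b c → Hᶜ.Adj c d → Hᶜ.Adj d e → Hᶜ.Adj e a →
      H.Adj a c → H.Adj b d → H.Adj c e → H.Adj d a →
      edgeLabel σ a b + edgeLabel σ b c + edgeLabel σ c d + edgeLabel σ d e +
        edgeLabel σ e a = 1) :
    IsAntiEvenBalancing σ := by
  intro n hn f
  have hn' := cycle_length_lt_six hH f
  interval_cases n
  · rw [sum_cycleGraph_three, if_pos rfl]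
    apply h₃ <;> exact f.map_adj_iff.2 (by decide)
  · rw [sum_cycleGraph_four, if_neg (by decide)]
    apply h₄ <;>
      first
      | exact f.map_adj_iff.2 (by decide)
      | exact adj_of_not_cycleGraph_adj f (by decide) (by decide)
  · rw [sum_cycleGraph_five, if_neg (by decide)]
    apply h₅ <;>
      first
      | exact f.map_adj_iff.2 (by decide)
      | exact adj_of_not_cycleGraph_adj f (by decide) (by decide)

/-! ### Labellings whose cycle sums vanish -/

/-- A symmetric function on pairs which vanishes on the diagonal and sums to `0` over the triangles
and the induced cycles of length `4` and `5` of `Hᶜ`. -/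
structure IsCycleNull (H : SimpleGraph V) (g : V → V → ZMod 2) : Prop where
  symm : ∀ a b, g a b = g b a
  self : ∀ a, g a a = 0
  triangle : ∀ a b c, Hᶜ.Adj a b → Hᶜ.Adj b c → Hᶜ.Adj c a → g a b + g b c + g c a = 0
  quadrilateral : ∀ a b c d, Hᶜ.Adj a b → Hᶜ.Adj b c → Hᶜ.Adj c d → Hᶜ.Adj d a → H.Adj a c →
    H.Adj b d → g a b + g b c + g c d + g d a = 0
  pentagon : ∀ a b c d e, Hᶜ.Adj a b → Hᶜ.Adj b c → Hᶜ.Adj c d → Hᶜ.Adj d e → Hᶜ.Adj e a →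
    H.Adj a c → H.Adj b d → H.Adj c e → H.Adj d a → H.Adj e b →
    g a b + g b c + g c d + g d e + g e a = 0

namespace IsCycleNull

variable {g : V → V → ZMod 2}

theorem triangle' (hg : IsCycleNull H g) {a b c : V} (hab : ¬ H.Adj a b) (hbc : ¬ H.Adj b c)
    (hca : ¬ H.Adj c a) : g a b + g b c + g c a = 0 := by
  rcases not_adj_iff_eq_or_compl_adj.1 hab with rfl | hab
  · rw [hg.self, zero_add, hg.symm c a]; exact CharTwo.add_self_eq_zero _
  rcases not_adj_iff_eq_or_compl_adj.1 hbc with rfl | hbc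
  · rw [hg.self, add_zero, hg.symm b a]; exact CharTwo.add_self_eq_zero _
  rcases not_adj_iff_eq_or_compl_adj.1 hca with rfl | hca
  · rw [hg.self, add_zero, hg.symm b c]; exact CharTwo.add_self_eq_zero _
  exact hg.triangle a b c hab hbc hca

theorem quadrilateral' (hg : IsCycleNull H g) {a b c d : V} (hab : ¬ H.Adj a b)
    (hbc : ¬ H.Adj b c) (hcd : ¬ H.Adj c d) (hda : ¬ H.Adj d a) :
    g a b + g b c + g c d + g d a = 0 := by
  by_cases hac : H.Adj a c
  · by_cases hbd : H.Adj b d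
    · refine hg.quadrilateral a b c d (compl_adj_of_not_adj ?_ hab) (compl_adj_of_not_adj ?_ hbc)
        (compl_adj_of_not_adj ?_ hcd) (compl_adj_of_not_adj ?_ hda) hac hbd
      · rintro rfl; exact hbc hac
      · rintro rfl; exact hab hac
      · rintro rfl; exact hbc hbd
      · rintro rfl; exact hcd hac.symm
    · have h1 := hg.triangle' hab hbd hda
      have h2 := hg.triangle' hbc hcd (fun h => hbd h.symm)
      rw [hg.symm d b] at h2
      linear_combination h1 + h2 - (CharTwo.add_self_eq_zero (g b d))
  · have h1 := hg.triangle' hab hbc (fun h => hac h.symm)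
    have h2 := hg.triangle' hac hcd hda
    rw [hg.symm c a] at h1
    linear_combination h1 + h2 - (CharTwo.add_self_eq_zero (g a c))

theorem pentagon_of_chord (hg : IsCycleNull H g) {a b c d e : V} (hab : ¬ H.Adj a b)
    (hbc : ¬ H.Adj b c) (hcd : ¬ H.Adj c d) (hde : ¬ H.Adj d e) (hea : ¬ H.Adj e a)
    (hac : ¬ H.Adj a c) : g a b + g b c + g c d + g d e + g e a = 0 := by
  have h1 := hg.triangle' hab hbc (fun h => hac h.symm)
  have h2 := hg.quadrilateral' hac hcd hde hea
  rw [hg.symm c a] at h1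
  linear_combination h1 + h2 - (CharTwo.add_self_eq_zero (g a c))

theorem pentagon' (hg : IsCycleNull H g) {a b c d e : V} (hab : ¬ H.Adj a b)
    (hbc : ¬ H.Adj b c) (hcd : ¬ H.Adj c d) (hde : ¬ H.Adj d e) (hea : ¬ H.Adj e a) :
    g a b + g b c + g c d + g d e + g e a = 0 := by
  by_cases hac : H.Adj a c; swap
  · exact hg.pentagon_of_chord hab hbc hcd hde hea hac
  by_cases hbd : H.Adj b d; swap
  · linear_combination hg.pentagon_of_chord hbc hcd hde hea hab hbd
  by_cases hce : H.Adj c e; swap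
  · linear_combination hg.pentagon_of_chord hcd hde hea hab hbc hce
  by_cases hda : H.Adj d a; swap
  · linear_combination hg.pentagon_of_chord hde hea hab hbc hcd hda
  by_cases heb : H.Adj e b; swap
  · linear_combination hg.pentagon_of_chord hea hab hbc hcd hde heb
  refine hg.pentagon a b c d e (compl_adj_of_not_adj ?_ hab) (compl_adj_of_not_adj ?_ hbc)
    (compl_adj_of_not_adj ?_ hcd) (compl_adj_of_not_adj ?_ hde) (compl_adj_of_not_adj ?_ hea)
    hac hbd hce hda heb
  · rintro rfl; exact hbc hac
  · rintro rfl; exact hab hac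
  · rintro rfl; exact hbc hbd
  · rintro rfl; exact hcd hce
  · rintro rfl; exact hde hda

/-- The sum along a walk from `o` of length at most two that passes through one of two adjacent
vertices `u`, `v` of `H` is a potential for `g`: since `H` has no triangles, each vertex can be
reached in this way, and an edge between two such walks closes a walk of length at most five. -/
theorem exists_potential (hg : IsCycleNull H g)
    (hH : ∀ ⦃x y z : V⦄, H.Adj x y → H.Adj y z → ¬ H.Adj x z) {o u v : V} (huv : H.Adj u v)
    (hou : ¬ H.Adj o u) (hov : ¬ H.Adj o v) :
    ∃ F : V → ZMod 2, ∀ x y, ¬ H.Adj x y → g x y = F x + F y := by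
  classical
  refine ⟨fun x => if H.Adj u x then g o v + g v x else g o u + g u x, fun x y hxy => ?_⟩
  have key : ∀ z, H.Adj u z → ¬ H.Adj v z := fun z h h' => hH huv h' h
  have hyx : ¬ H.Adj y x := fun h => hxy h.symm
  have step : ∀ w, ¬ H.Adj w x → ¬ H.Adj w y → g x y = (g o w + g w x) + (g o w + g w y) := by
    intro w hwx hwy
    have := hg.triangle' hwx hxy (fun h => hwy h.symm)
    rw [hg.symm y w] at this
    linear_combination this - CharTwo.add_self_eq_zero (g o w) - CharTwo.add_self_eq_zero (g w x) -
      CharTwo.add_self_eq_zero (g w y)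
  have step' : ∀ w w', ¬ H.Adj o w → ¬ H.Adj o w' → ∀ x y, ¬ H.Adj x y → ¬ H.Adj w x →
      ¬ H.Adj w' y → g x y = (g o w + g w x) + (g o w' + g w' y) := by
    intro w w' how how' x y hxy hwx hwy
    have := hg.pentagon' how hwx hxy (fun h => hwy h.symm) (fun h => how' h.symm)
    rw [hg.symm y w', hg.symm w' o] at this
    linear_combination this - CharTwo.add_self_eq_zero (g o w) - CharTwo.add_self_eq_zero (g w x) -
      CharTwo.add_self_eq_zero (g w' y) - CharTwo.add_self_eq_zero (g o w')
  by_cases hx : H.Adj u x <;> by_cases hy : H.Adj u y <;> simp only [hx, hy, if_true, if_false]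
  · exact step v (key x hx) (key y hy)
  · exact step' v u hov hou x y hxy (key x hx) hy
  · exact step' u v hou hov x y hxy hx (key y hy)
  · exact step u hx hy

end IsCycleNull

end Combinatorics

/-! ### The anti-even-balancing labellings of the complement of `genericC3` -/

/-- The labelling `σ` is the sum of the coboundary of `f` and of the winding labelling. -/
def IsPotential (σ : Labelling genericC3ᶜ) (f : C3Vertex → ZMod 2) : Prop :=
  ∀ x y, genericC3ᶜ.Adj x y → edgeLabel σ x y = f x + f y + winding x y

/-- The labelling with potential `f`. -/
noncomputable def labellingOfPotential (f : C3Vertex → ZMod 2) : Labelling genericC3ᶜ := fun e =>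
  Sym2.lift ⟨fun x y => f x + f y + winding x y, fun x y => by
    simp only [winding_comm x y, add_comm (f x)]⟩ e.1

theorem isPotential_labellingOfPotential (f : C3Vertex → ZMod 2) :
    IsPotential (labellingOfPotential f) f := by
  intro x y h
  rw [edgeLabel_of_adj _ h]
  rfl

theorem IsPotential.isAntiEvenBalancing {σ : Labelling genericC3ᶜ} {f : C3Vertex → ZMod 2}
    (h : IsPotential σ f) : IsAntiEvenBalancing σ := by
  have nadj : ∀ {x y}, genericC3ᶜ.Adj x y → ¬ genericC3.Adj x y := fun h =>
    ((genericC3.compl_adj _ _).1 h).2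
  refine isAntiEvenBalancing_of_cycles (fun _ _ _ => genericC3_triangle_free) ?_ ?_ ?_
  · intro a b c hab hbc hca
    have hw := winding_triangle (nadj hab) (nadj hbc) (nadj hca.symm)
    rw [h _ _ hab, h _ _ hbc, h _ _ hca, winding_comm c a, ← hw]
    linear_combination CharTwo.add_self_eq_zero (f a) + CharTwo.add_self_eq_zero (f b) +
      CharTwo.add_self_eq_zero (f c) + CharTwo.add_self_eq_zero (winding a b) +
      CharTwo.add_self_eq_zero (winding b c)
  · intro a b c d hab hbc hcd hda hac hbd
    have hw := winding_quadrilateral (nadj hab) (nadj hbc) (nadj hcd) (nadj hda) hac hbd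
    rw [h _ _ hab, h _ _ hbc, h _ _ hcd, h _ _ hda]
    linear_combination hw + CharTwo.add_self_eq_zero (f a) + CharTwo.add_self_eq_zero (f b) +
      CharTwo.add_self_eq_zero (f c) + CharTwo.add_self_eq_zero (f d)
  · intro a b c d e hab hbc hcd hde hea hac hbd hce hda
    have hw := winding_pentagon (nadj hab) (nadj hbc) (nadj hcd) (nadj hde) (nadj hea) hac hbd hce
      hda
    rw [h _ _ hab, h _ _ hbc, h _ _ hcd, h _ _ hde, h _ _ hea]
    linear_combination hw + CharTwo.add_self_eq_zero (f a) + CharTwo.add_self_eq_zero (f b) +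
      CharTwo.add_self_eq_zero (f c) + CharTwo.add_self_eq_zero (f d) +
      CharTwo.add_self_eq_zero (f e)

/-- Two anti-even-balancing labellings have the same sum over each induced cycle, so an
anti-even-balancing labelling differs from the winding labelling by a coboundary. -/
theorem IsAntiEvenBalancing.exists_isPotential {σ : Labelling genericC3ᶜ}
    (hσ : IsAntiEvenBalancing σ) (p : SimpleGraph.cycleGraph 5 ↪g genericC3ᶜ) :
    ∃ f, IsPotential σ f := by
  set τ := labellingOfPotential 0
  have hτ : IsAntiEvenBalancing τ := (isPotential_labellingOfPotential 0).isAntiEvenBalancing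
  have htwo : (1 : ZMod 2) + 1 = 0 := rfl
  have hg : IsCycleNull genericC3 (fun x y => edgeLabel σ x y + edgeLabel τ x y) :=
    { symm := fun a b => by rw [edgeLabel_comm σ, edgeLabel_comm τ]
      self := fun a => by rw [edgeLabel_self, edgeLabel_self, add_zero]
      triangle := fun a b c h1 h2 h3 => by
        linear_combination hσ.triangle h1 h2 h3 + hτ.triangle h1 h2 h3
      quadrilateral := fun a b c d h1 h2 h3 h4 h5 h6 => by
        linear_combination hσ.quadrilateral h1 h2 h3 h4 h5 h6 +
          hτ.quadrilateral h1 h2 h3 h4 h5 h6 + htwo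
      pentagon := fun a b c d e h1 h2 h3 h4 h5 h6 h7 h8 h9 h10 => by
        linear_combination hσ.pentagon h1 h2 h3 h4 h5 h6 h7 h8 h9 h10 +
          hτ.pentagon h1 h2 h3 h4 h5 h6 h7 h8 h9 h10 + htwo }
  have nadj : ∀ {i j}, (SimpleGraph.cycleGraph 5).Adj i j → ¬ genericC3.Adj (p i) (p j) :=
    fun h => ((genericC3.compl_adj _ _).1 (p.map_adj_iff.2 h)).2
  obtain ⟨F, hF⟩ := hg.exists_potential (fun _ _ _ => genericC3_triangle_free)
    (adj_of_not_cycleGraph_adj p (i := 1) (j := 4) (by decide) (by decide))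
    (nadj (i := 0) (j := 1) (by decide)) (nadj (i := 0) (j := 4) (by decide))
  refine ⟨F, fun x y h => ?_⟩
  have h1 := hF x y ((genericC3.compl_adj _ _).1 h).2
  have h2 := isPotential_labellingOfPotential 0 x y h
  simp only [Pi.zero_apply, zero_add] at h2
  rw [← h1, ← h2]
  linear_combination -CharTwo.add_self_eq_zero (edgeLabel τ x y)

theorem exists_isFirstNeighbour (p : SimpleGraph.cycleGraph 5 ↪g genericC3ᶜ) (x : C3Vertex) :
    ∃ i, IsFirstNeighbour p x i := by
  have hex : ∃ i, genericC3ᶜ.Adj x (p i) := by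
    by_cases h1 : x = p 1
    · exact ⟨0, h1 ▸ p.map_adj_iff.2 (by decide)⟩
    by_cases h4 : x = p 4
    · exact ⟨0, h4 ▸ p.map_adj_iff.2 (by decide)⟩
    by_cases hx : genericC3.Adj x (p 1)
    · refine ⟨4, compl_adj_of_not_adj h4 fun h => genericC3_triangle_free hx.symm h ?_⟩
      exact adj_of_not_cycleGraph_adj p (by decide) (by decide)
    · exact ⟨1, compl_adj_of_not_adj h1 hx⟩
  classical
  exact ⟨Fin.find _ hex, Fin.find_spec hex, fun j hj => Fin.find_min hex hj⟩

theorem IsFirstNeighbour.unique {p : SimpleGraph.cycleGraph 5 ↪g genericC3ᶜ} {x : C3Vertex}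
    {i j : Fin 5} (hi : IsFirstNeighbour p x i) (hj : IsFirstNeighbour p x j) : i = j :=
  le_antisymm (not_lt.1 fun h => hi.2 j h hj.1) (not_lt.1 fun h => hj.2 i h hi.1)

theorem isFirstNeighbour_of_cycleGraph (p : SimpleGraph.cycleGraph 5 ↪g genericC3ᶜ) {i j : Fin 5}
    (h : (SimpleGraph.cycleGraph 5).Adj i j)
    (h' : ∀ k < j, ¬ (SimpleGraph.cycleGraph 5).Adj i k) : IsFirstNeighbour p (p i) j :=
  ⟨p.map_adj_iff.2 h, fun k hk hk' => h' k hk (p.map_adj_iff.1 hk')⟩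

theorem ExtendsTreeLabelling.potential_eq {C₁ : Set C3Vertex}
    {p : SimpleGraph.cycleGraph 5 ↪g genericC3ᶜ} {e : ZMod 2} {σ : Labelling genericC3ᶜ}
    (h : ExtendsTreeLabelling C₁ p e σ) {f : C3Vertex → ZMod 2} (hf : IsPotential σ f)
    {x : C3Vertex} {i : Fin 5} (hi : IsFirstNeighbour p x i) (h0 : x ≠ p 0) (h1 : x ≠ p 1) :
    f x = C₁.indicator 1 x + f (p i) + winding x (p i) := by
  have := hf x (p i) hi.1
  rw [edgeLabel_of_adj _ hi.1, h.1 x i hi h0 h1] at this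
  rw [this]
  linear_combination -CharTwo.add_self_eq_zero (f (p i)) -
    CharTwo.add_self_eq_zero (winding x (p i))

/-- The values of a potential on the tree edges determine its differences along the tree. -/
theorem existsUnique_labelling (C₁ : Set C3Vertex) (p : SimpleGraph.cycleGraph 5 ↪g genericC3ᶜ)
    (e : ZMod 2) : ∃! σ : Labelling genericC3ᶜ, IsAntiEvenBalancing σ ∧
      ExtendsTreeLabelling C₁ p e σ := by
  classical
  have first : ∀ {i j : Fin 5}, (SimpleGraph.cycleGraph 5).Adj i j →
      (∀ k < j, ¬ (SimpleGraph.cycleGraph 5).Adj i k) → IsFirstNeighbour p (p i) j :=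
    isFirstNeighbour_of_cycleGraph p
  have h10 : genericC3ᶜ.Adj (p 0) (p 1) := p.map_adj_iff.2 (by decide)
  choose n hn using exists_isFirstNeighbour p
  have n2 : n (p 2) = 1 := (hn _).unique (first (by decide) (by decide))
  have n3 : n (p 3) = 2 := (hn _).unique (first (by decide) (by decide))
  have n4 : n (p 4) = 0 := (hn _).unique (first (by decide) (by decide))
  have pne : ∀ {i j : Fin 5}, i ≠ j → p i ≠ p j := fun h => p.injective.ne h
  set d : C3Vertex → ZMod 2 := fun x => C₁.indicator 1 x + winding x (p (n x)) with hd
  -- The values of the potential on the five-cycle, along the path `p 0, p 1, p 2, p 3` and the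
  -- edge from `p 0` to `p 4`.
  set c : Fin 5 → ZMod 2 := ![0, e + winding (p 0) (p 1), d (p 2) + (e + winding (p 0) (p 1)),
    d (p 3) + (d (p 2) + (e + winding (p 0) (p 1))), d (p 4)] with hc
  set f : C3Vertex → ZMod 2 := fun x => if x = p 0 then c 0 else if x = p 1 then c 1 else
    d x + c (n x) with hf
  have f0 : f (p 0) = c 0 := by simp [hf]
  have f1 : f (p 1) = c 1 := by
    change (if p 1 = p 0 then c 0 else if p 1 = p 1 then c 1 else d (p 1) + c (n (p 1))) = c 1
    rw [if_neg (pne (by decide)), if_pos rfl]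
  have fx : ∀ x, x ≠ p 0 → x ≠ p 1 → f x = d x + c (n x) := fun x h0 h1 => by
    simp only [hf]
    rw [if_neg h0, if_neg h1]
  have fp : ∀ i, f (p i) = c i := by
    intro i
    match i with
    | 0 => exact f0
    | 1 => exact f1
    | 2 => rw [fx _ (pne (by decide)) (pne (by decide)), n2]; rfl
    | 3 => rw [fx _ (pne (by decide)) (pne (by decide)), n3]; rfl
    | 4 => rw [fx _ (pne (by decide)) (pne (by decide)), n4]; exact add_zero _
  have hpot := isPotential_labellingOfPotential f
  refine ⟨labellingOfPotential f, ⟨hpot.isAntiEvenBalancing, ?_, ?_⟩, ?_⟩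
  · intro x i h h0 h1
    obtain rfl : n x = i := (hn x).unique h
    refine (edgeLabel_of_adj _ h.1).symm.trans ?_
    rw [hpot x _ h.1, fx x h0 h1, fp]
    simp only [hd]
    linear_combination CharTwo.add_self_eq_zero (winding x (p (n x))) +
      CharTwo.add_self_eq_zero (c (n x))
  · intro h
    refine (edgeLabel_of_adj _ h).symm.trans ?_
    rw [hpot _ _ h, f0, f1]
    change 0 + (e + winding (p 0) (p 1)) + winding (p 0) (p 1) = e
    linear_combination CharTwo.add_self_eq_zero (winding (p 0) (p 1))
  · rintro σ ⟨hσ, hext⟩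
    obtain ⟨k, hk⟩ := hσ.exists_isPotential p
    -- The two potentials differ by the constant `k (p 0)`.
    have k1 : k (p 1) = c 1 + k (p 0) := by
      have := hk _ _ h10
      rw [edgeLabel_of_adj _ h10, hext.2 h10] at this
      change _ = e + winding (p 0) (p 1) + k (p 0)
      rw [this]
      linear_combination -CharTwo.add_self_eq_zero (k (p 0)) -
        CharTwo.add_self_eq_zero (winding (p 0) (p 1))
    have kx : ∀ x, x ≠ p 0 → x ≠ p 1 → k x = d x + k (p (n x)) := fun x h0 h1 => by
      rw [hext.potential_eq hk (hn x) h0 h1]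
      simp only [hd]
      ring
    have kp : ∀ i, k (p i) = c i + k (p 0) := by
      have k2 : k (p 2) = c 2 + k (p 0) := by
        rw [kx _ (pne (by decide)) (pne (by decide)), n2, k1, ← add_assoc]; rfl
      intro i
      match i with
      | 0 => exact (zero_add _).symm
      | 1 => exact k1
      | 2 => exact k2
      | 3 => rw [kx _ (pne (by decide)) (pne (by decide)), n3, k2, ← add_assoc]; rfl
      | 4 => rw [kx _ (pne (by decide)) (pne (by decide)), n4]; rfl
    have kf : ∀ x, k x = f x + k (p 0) := by
      intro x
      by_cases h0 : x = p 0
      · rw [h0, f0]; exact kp 0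
      by_cases h1 : x = p 1
      · rw [h1, f1]; exact kp 1
      rw [kx x h0 h1, fx x h0 h1, kp, ← add_assoc]
    funext ⟨s, hs⟩
    induction s using Sym2.ind with
    | _ x y =>
      rw [← edgeLabel_of_adj σ hs, ← edgeLabel_of_adj (labellingOfPotential f) hs, hk _ _ hs,
        hpot _ _ hs, kf x, kf y]
      linear_combination CharTwo.add_self_eq_zero (k (p 0))

/-! ### Density of the values of the potential -/

theorem continuous_circleCoord : Continuous circleCoord := by
  refine Continuous.mul (continuous_iff_continuousAt.2 fun x => ?_) continuous_const
  exact (Complex.continuousAt_arg (Complex.mem_slitPlane_iff_arg.2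
    ⟨x.arg_lt_pi.ne, x.ne_zero⟩)).comp (f := fun y : C3Vertex => y.1)
    continuous_subtype_val.continuousAt

theorem exists_circleCoord_mem {l u : ℝ} (hlu : l < u) (hl : -(3 / 2) ≤ l) (hu : u ≤ 3 / 2) :
    ∃ x : C3Vertex, l < circleCoord x ∧ circleCoord x < u := by
  have hpi := Real.pi_pos
  obtain ⟨q, hq1, hq2⟩ := exists_rat_btwn (show l * (2 * Real.pi / 3) < u * (2 * Real.pi / 3) from
    mul_lt_mul_of_pos_right hlu (by positivity))
  have harg : (Complex.exp ((q : ℝ) * Complex.I)).arg = q := by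
    rw [Complex.exp_mul_I, Complex.arg_cos_add_sin_mul_I]
    constructor <;> nlinarith
  have key : circleCoord ⟨Complex.exp ((q : ℝ) * Complex.I),
      Complex.norm_exp_ofReal_mul_I _, q, harg⟩ = q * (3 / (2 * Real.pi)) := by
    unfold circleCoord
    rw [harg]
  refine ⟨_, key.symm.subst (motive := (l < ·)) ?_, key.symm.subst (motive := (· < u)) ?_⟩
  · rw [mul_div_assoc', lt_div_iff₀ (by positivity)]; linarith
  · rw [mul_div_assoc', div_lt_iff₀ (by positivity)]; linarith

theorem eventually_genericC3_adj_iff (x y : C3Vertex) :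
    ∀ᶠ z in nhds x, (genericC3.Adj z y ↔ genericC3.Adj x y) ∧ winding z y = winding x y := by
  have hcont : Filter.Tendsto (fun z => |circleCoord z - circleCoord y|) (nhds x)
      (nhds |circleCoord x - circleCoord y|) :=
    ((continuous_circleCoord.sub continuous_const).abs).continuousAt
  by_cases h : genericC3.Adj x y
  · have h' := genericC3_adj_iff.1 h
    filter_upwards [hcont.eventually_const_lt h'.1, hcont.eventually_lt_const h'.2] with z h1 h2
    refine ⟨iff_of_true (genericC3_adj_iff.2 ⟨h1, h2⟩) h, ?_⟩
    unfold winding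
    rw [if_neg h2.not_gt, if_neg h'.2.not_gt]
  · rcases not_genericC3_adj_iff.1 h with h' | h'
    · filter_upwards [hcont.eventually_lt_const h'] with z h1
      refine ⟨iff_of_false (not_genericC3_adj_iff.2 (Or.inl h1)) h, ?_⟩
      unfold winding
      rw [if_neg (by linarith), if_neg (by linarith)]
    · filter_upwards [hcont.eventually_const_lt h'] with z h1
      refine ⟨iff_of_false (not_genericC3_adj_iff.2 (Or.inr h1)) h, ?_⟩
      unfold winding
      rw [if_pos h1, if_pos h']

/-- Away from `p 0, …, p 4`, the vertex `p_x` and the winding of the edge `x p_x` are locally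
constant in `x`, so there the potential differs by a local constant from the indicator function
of `C₁`. -/
theorem exists_potential_eq_of_interval {C₀ C₁ : Set C3Vertex} (hC : IsCompl C₀ C₁)
    (h₀ : Dense C₀) (h₁ : Dense C₁) {p : SimpleGraph.cycleGraph 5 ↪g genericC3ᶜ} {e : ZMod 2}
    {σ : Labelling genericC3ᶜ} (hext : ExtendsTreeLabelling C₁ p e σ) {f : C3Vertex → ZMod 2}
    (hf : IsPotential σ f) {l u : ℝ} (hlu : l < u) (hl : -(3 / 2) ≤ l) (hu : u ≤ 3 / 2)
    (v : ZMod 2) : ∃ x, l < circleCoord x ∧ circleCoord x < u ∧ f x = v := by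
  have hopen : IsOpen (circleCoord ⁻¹' Set.Ioo l u) := isOpen_Ioo.preimage continuous_circleCoord
  obtain ⟨x, hx, hxp⟩ : ∃ x, circleCoord x ∈ Set.Ioo l u ∧ ∀ i, x ≠ p i := by
    have hinf : (circleCoord ⁻¹' Set.Ioo l u).Infinite := by
      intro hfin
      -- A largest element of a finite set of coordinates leaves an interval above it without
      -- vertices.
      obtain ⟨y, hy⟩ := exists_circleCoord_mem hlu hl hu
      obtain ⟨m, hm, hmax⟩ := hfin.exists_maximalFor circleCoord _ ⟨y, hy⟩
      obtain ⟨z, hz1, hz2⟩ := exists_circleCoord_mem hm.2 (hl.trans hm.1.le) hu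
      exact absurd (hmax ⟨hm.1.trans hz1, hz2⟩ hz1.le) hz1.not_ge
    obtain ⟨x, hx, hx'⟩ := (hinf.sdiff (Set.finite_range p)).nonempty
    exact ⟨x, hx, fun i h => hx' ⟨i, h.symm⟩⟩
  obtain ⟨i, hi⟩ := exists_isFirstNeighbour p x
  have hnear : ∀ᶠ z in nhds x, circleCoord z ∈ Set.Ioo l u ∧ ∀ j, z ≠ p j ∧
      (genericC3.Adj z (p j) ↔ genericC3.Adj x (p j)) ∧ winding z (p j) = winding x (p j) :=
    (hopen.eventually_mem hx).and (Filter.eventually_all.2 fun j =>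
      ((continuous_id.continuousAt (x := x)).eventually_ne (hxp j)).and
        (eventually_genericC3_adj_iff x (p j)))
  obtain ⟨z, hz, hzv⟩ : ∃ z, (circleCoord z ∈ Set.Ioo l u ∧ ∀ j, z ≠ p j ∧
      (genericC3.Adj z (p j) ↔ genericC3.Adj x (p j)) ∧ winding z (p j) = winding x (p j)) ∧
      (C₁.indicator 1 z : ZMod 2) = v + f (p i) + winding x (p i) := by
    obtain ⟨O, hO, hOo, hxO⟩ := eventually_nhds_iff.1 hnear
    rcases (by decide : ∀ w : ZMod 2, w = 0 ∨ w = 1) (v + f (p i) + winding x (p i)) with hw | hw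
    · obtain ⟨z, hz, hz'⟩ := h₀.inter_open_nonempty O hOo ⟨x, hxO⟩
      exact ⟨z, hO z hz, by
        rw [hw, Set.indicator_of_notMem (Set.disjoint_left.1 hC.disjoint hz')]⟩
    · obtain ⟨z, hz, hz'⟩ := h₁.inter_open_nonempty O hOo ⟨x, hxO⟩
      exact ⟨z, hO z hz, by rw [hw, Set.indicator_of_mem hz', Pi.one_apply]⟩
  have hadj : ∀ j, genericC3ᶜ.Adj z (p j) ↔ genericC3ᶜ.Adj x (p j) := fun j => by
    rw [genericC3.compl_adj, genericC3.compl_adj, (hz.2 j).2.1]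
    simp only [(hz.2 j).1, hxp j, ne_eq, not_false_eq_true, true_and]
  have hzi : IsFirstNeighbour p z i :=
    ⟨(hadj i).2 hi.1, fun j hj h => hi.2 j hj ((hadj j).1 h)⟩
  refine ⟨z, hz.1.1, hz.1.2, ?_⟩
  rw [hext.potential_eq hf hzi (hz.2 0).1 (hz.2 1).1, hzv, (hz.2 i).2.2]
  linear_combination CharTwo.add_self_eq_zero (f (p i)) +
    CharTwo.add_self_eq_zero (winding x (p i))

/-- Intervals of the circle that contain the jump of the coordinate are described by lifts of their
end points to the real line. -/
theorem exists_lifted_potential_eq {f : C3Vertex → ZMod 2}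
    (hf : ∀ {l u : ℝ}, l < u → -(3 / 2) ≤ l → u ≤ 3 / 2 → ∀ v,
      ∃ x, l < circleCoord x ∧ circleCoord x < u ∧ f x = v) {l u : ℝ} (hlu : l < u) :
    ∃ m : ℤ, ∀ v, ∃ x, l < circleCoord x + 3 * m ∧ circleCoord x + 3 * m < u ∧ f x = v := by
  -- The translate of the circle that contains `l` and points to the right of it.
  set m : ℤ := ⌊(l + 3 / 2) / 3⌋ with hm
  have h1 : (m : ℝ) ≤ (l + 3 / 2) / 3 := Int.floor_le _
  have h2 : (l + 3 / 2) / 3 < m + 1 := Int.lt_floor_add_one _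
  refine ⟨m, fun v => ?_⟩
  obtain ⟨x, hx1, hx2, hx3⟩ := hf (l := l - 3 * m) (u := min (u - 3 * m) (3 / 2))
    (lt_min (by linarith) (by linarith)) (by linarith) (min_le_right _ _) v
  have := lt_min_iff.1 hx2
  exact ⟨x, by linarith, by linarith [this.1], hx3⟩

/-! ### Atoms of pairs -/

/-- The atom of an edge with the given label. -/
def labelAtom (v : ZMod 2) : Atom56 := if v = 0 then Atom56.zero else Atom56.one

section PairAtom

variable {V : Type*} {H : SimpleGraph V}

theorem pairAtom_self {G : SimpleGraph V} (σ : Labelling G) (x : V) :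
    pairAtom σ x x = Atom56.ident := if_pos rfl

theorem pairAtom_of_compl_adj (σ : Labelling Hᶜ) {x y : V} (h : Hᶜ.Adj x y) :
    pairAtom σ x y = labelAtom (edgeLabel σ x y) := by
  unfold pairAtom labelAtom
  rw [if_neg h.ne, dif_pos h, edgeLabel_of_adj σ h]

theorem pairAtom_of_adj (σ : Labelling Hᶜ) {x y : V} (h : H.Adj x y) :
    pairAtom σ x y = Atom56.N := by
  unfold pairAtom
  rw [if_neg h.ne, dif_neg fun h' => ((H.compl_adj x y).1 h').2 h]

theorem pairAtom_cases (σ : Labelling Hᶜ) {x y : V} (hxy : x ≠ y) :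
    H.Adj x y ∧ pairAtom σ x y = Atom56.N ∨
      Hᶜ.Adj x y ∧ pairAtom σ x y = labelAtom (edgeLabel σ x y) := by
  by_cases h : H.Adj x y
  · exact Or.inl ⟨h, pairAtom_of_adj σ h⟩
  · have h := compl_adj_of_not_adj hxy h
    exact Or.inr ⟨h, pairAtom_of_compl_adj σ h⟩

theorem pairAtom_comm (σ : Labelling Hᶜ) (x y : V) : pairAtom σ x y = pairAtom σ y x := by
  rcases eq_or_ne x y with rfl | hxy
  · rfl
  rcases pairAtom_cases σ hxy with ⟨h, h'⟩ | ⟨h, h'⟩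
  · rw [h', pairAtom_of_adj σ h.symm]
  · rw [h', pairAtom_of_compl_adj σ h.symm, edgeLabel_comm]

theorem pairAtom_eq_ident_iff (σ : Labelling Hᶜ) {x y : V} :
    pairAtom σ x y = Atom56.ident ↔ x = y := by
  refine ⟨fun h => ?_, fun h => h ▸ pairAtom_self σ x⟩
  by_contra hxy
  rcases pairAtom_cases σ hxy with ⟨_, h'⟩ | ⟨_, h'⟩
  · rw [h'] at h; cases h
  · rw [h'] at h
    revert h
    generalize edgeLabel σ x y = v
    revert v
    decide

theorem not_forbidden_pairAtom (hH : ∀ ⦃x y z : V⦄, H.Adj x y → H.Adj y z → ¬ H.Adj x z)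
    {σ : Labelling Hᶜ} (hσ : IsAntiEvenBalancing σ) (x y z : V) :
    ¬ Atom56.Forbidden (pairAtom σ x y) (pairAtom σ y z) (pairAtom σ x z) := by
  have f1 : ∀ a, ¬ Atom56.Forbidden Atom56.ident a a := by decide
  have f2 : ∀ a, ¬ Atom56.Forbidden a Atom56.ident a := by decide
  have f3 : ∀ a, ¬ Atom56.Forbidden a a Atom56.ident := by decide
  rcases eq_or_ne x y with rfl | hxy
  · rw [pairAtom_self]; exact f1 _
  rcases eq_or_ne y z with rfl | hyz
  · rw [pairAtom_self]; exact f2 _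
  rcases eq_or_ne x z with rfl | hxz
  · rw [pairAtom_self, pairAtom_comm σ y x]; exact f3 _
  have g1 : ∀ u v w : ZMod 2, u + v + w = 0 →
    ¬ Atom56.Forbidden (labelAtom u) (labelAtom v) (labelAtom w) := by decide
  have g2 : ∀ u v : ZMod 2, ¬ Atom56.Forbidden (labelAtom u) (labelAtom v) Atom56.N := by decide
  have g3 : ∀ u v : ZMod 2, ¬ Atom56.Forbidden (labelAtom u) Atom56.N (labelAtom v) := by decide
  have g4 : ∀ u v : ZMod 2, ¬ Atom56.Forbidden Atom56.N (labelAtom u) (labelAtom v) := by decide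
  have g5 : ∀ u : ZMod 2, ¬ Atom56.Forbidden Atom56.N Atom56.N (labelAtom u) := by decide
  have g6 : ∀ u : ZMod 2, ¬ Atom56.Forbidden Atom56.N (labelAtom u) Atom56.N := by decide
  have g7 : ∀ u : ZMod 2, ¬ Atom56.Forbidden (labelAtom u) Atom56.N Atom56.N := by decide
  rcases pairAtom_cases σ hxy with ⟨h₁, e₁⟩ | ⟨h₁, e₁⟩ <;>
  rcases pairAtom_cases σ hyz with ⟨h₂, e₂⟩ | ⟨h₂, e₂⟩ <;>
  rcases pairAtom_cases σ hxz with ⟨h₃, e₃⟩ | ⟨h₃, e₃⟩ <;>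
  rw [e₁, e₂, e₃]
  · exact absurd h₃ (hH h₁ h₂)
  · exact g5 _
  · exact g6 _
  · exact g4 _ _
  · exact g7 _
  · exact g3 _ _
  · exact g2 _ _
  · refine g1 _ _ _ ?_
    rw [edgeLabel_comm σ x z]
    exact hσ.triangle h₁ h₂ h₃.symm

end PairAtom

/-! ### The representation -/

/-- Every interval of the circle, given by lifts `l < u` of its end points, contains vertices at
which `f` takes any prescribed value. The lift `m` does not depend on the value. -/
def HasDenseValues (f : C3Vertex → ZMod 2) : Prop :=
  ∀ ⦃l u : ℝ⦄, l < u → ∃ m : ℤ, ∀ v, ∃ x, l < circleCoord x + 3 * m ∧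
    circleCoord x + 3 * m < u ∧ f x = v

theorem IsPotential.pairAtom_of_lift {σ : Labelling genericC3ᶜ} {f : C3Vertex → ZMod 2}
    (hf : IsPotential σ f) {x y : C3Vertex} (k : ℤ)
    (h₀ : circleCoord y - circleCoord x + 3 * k ≠ 0)
    (h₁ : -1 < circleCoord y - circleCoord x + 3 * k)
    (h₂ : circleCoord y - circleCoord x + 3 * k < 1) :
    pairAtom σ x y = labelAtom (f x + f y + k) := by
  have h := not_genericC3_adj_of_lift k (abs_lt.2 ⟨h₁, h₂⟩)
  have hne : x ≠ y := by
    rintro rfl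
    rw [sub_self, zero_add] at h₀ h₁ h₂
    have h1 : (-1 : ℝ) < k := by linarith
    have h2 : (k : ℝ) < 1 := by linarith
    have h1' : -1 < k := by exact_mod_cast h1
    have h2' : k < 1 := by exact_mod_cast h2
    obtain rfl : k = 0 := by omega
    simp at h₀
  have hadj := compl_adj_of_not_adj hne h.1
  rw [pairAtom_of_compl_adj σ hadj, hf x y hadj, h.2]

theorem pairAtom_eq_N_of_lift {σ : Labelling genericC3ᶜ} {x y : C3Vertex} (k : ℤ)
    (h₁ : 1 < circleCoord y - circleCoord x + 3 * k)
    (h₂ : circleCoord y - circleCoord x + 3 * k < 2) : pairAtom σ x y = Atom56.N :=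
  pairAtom_of_adj σ (genericC3_adj_of_lift k h₁ h₂)

theorem atom_cases (a : Atom56) :
    a = Atom56.ident ∨ a = Atom56.N ∨ ∃ v : ZMod 2, a = labelAtom v := by
  revert a; decide

section Extension

variable {σ : Labelling genericC3ᶜ} {f : C3Vertex → ZMod 2}

theorem exists_pairAtom_eq (hf : IsPotential σ f) (hd : HasDenseValues f) (a : C3Vertex)
    (x : Atom56) : ∃ c, pairAtom σ a c = x := by
  rcases atom_cases x with rfl | rfl | ⟨v, rfl⟩
  · exact ⟨a, pairAtom_self σ a⟩
  · obtain ⟨m, hm⟩ := hd (show circleCoord a + 1 < circleCoord a + 2 by linarith)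
    obtain ⟨c, h1, h2, -⟩ := hm 0
    exact ⟨c, pairAtom_eq_N_of_lift m (by linarith) (by linarith)⟩
  · obtain ⟨m, hm⟩ := hd (show circleCoord a < circleCoord a + 1 by linarith)
    obtain ⟨c, h1, h2, h3⟩ := hm (v + f a + m)
    refine ⟨c, ?_⟩
    rw [hf.pairAtom_of_lift m (by linarith) (by linarith) (by linarith), h3]
    congr 1
    linear_combination CharTwo.add_self_eq_zero (f a) + CharTwo.add_self_eq_zero (m : ZMod 2)

theorem exists_label_N_of_compl_adj (hf : IsPotential σ f) (hd : HasDenseValues f) {a b : C3Vertex}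
    (h : genericC3ᶜ.Adj a b) (v : ZMod 2) :
    ∃ c, pairAtom σ a c = labelAtom v ∧ pairAtom σ c b = Atom56.N := by
  obtain ⟨k, d, hk, hd1, hd2, -⟩ := exists_displacement ((genericC3.compl_adj _ _).1 h).2
  have hd0 : d ≠ 0 := by
    rintro rfl
    have h0 := (abs_circleCoord_sub_lt a b)
    rcases eq_of_abs_add_three_mul_lt h0 (by rw [hk]; norm_num) with rfl | rfl | rfl <;>
      push_cast at hk
    · rw [abs_lt] at h0; linarith
    · exact h.ne (circleCoord_injective (by linarith))
    · rw [abs_lt] at h0; linarith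
  rcases lt_or_gt_of_ne hd0 with hneg | hpos
  · obtain ⟨m, hm⟩ := hd (show circleCoord b + 3 * k + 1 < circleCoord a + 1 by linarith)
    obtain ⟨c, h1, h2, h3⟩ := hm (v + f a + m)
    refine ⟨c, ?_, ?_⟩
    · rw [hf.pairAtom_of_lift m (by linarith) (by linarith) (by linarith), h3]
      congr 1
      linear_combination CharTwo.add_self_eq_zero (f a) + CharTwo.add_self_eq_zero (m : ZMod 2)
    · rw [pairAtom_comm]
      exact pairAtom_eq_N_of_lift (m - k) (by push_cast; linarith) (by push_cast; linarith)
  · obtain ⟨m, hm⟩ := hd (show circleCoord a - 1 < circleCoord b + 3 * k - 1 by linarith)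
    obtain ⟨c, h1, h2, h3⟩ := hm (v + f a + m)
    refine ⟨c, ?_, ?_⟩
    · rw [hf.pairAtom_of_lift m (by linarith) (by linarith) (by linarith), h3]
      congr 1
      linear_combination CharTwo.add_self_eq_zero (f a) + CharTwo.add_self_eq_zero (m : ZMod 2)
    · exact pairAtom_eq_N_of_lift (k - m) (by push_cast; linarith) (by push_cast; linarith)

theorem exists_N_N_of_compl_adj (hd : HasDenseValues f) {a b : C3Vertex}
    (h : genericC3ᶜ.Adj a b) :
    ∃ c, pairAtom σ a c = Atom56.N ∧ pairAtom σ c b = Atom56.N := by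
  obtain ⟨k, d, hk, hd1, hd2, -⟩ := exists_displacement ((genericC3.compl_adj _ _).1 h).2
  obtain ⟨m, hm⟩ := hd (show max (circleCoord a) (circleCoord b + 3 * k) + 1 <
    min (circleCoord a) (circleCoord b + 3 * k) + 2 by
      rcases le_total (circleCoord a) (circleCoord b + 3 * k) with h | h
      · rw [max_eq_right h, min_eq_left h]; linarith
      · rw [max_eq_left h, min_eq_right h]; linarith)
  obtain ⟨c, h1, h2, -⟩ := hm 0
  have := le_max_left (circleCoord a) (circleCoord b + 3 * k)
  have := le_max_right (circleCoord a) (circleCoord b + 3 * k)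
  have := min_le_left (circleCoord a) (circleCoord b + 3 * k)
  have := min_le_right (circleCoord a) (circleCoord b + 3 * k)
  refine ⟨c, pairAtom_eq_N_of_lift m (by linarith) (by linarith), ?_⟩
  rw [pairAtom_comm]
  exact pairAtom_eq_N_of_lift (m - k) (by push_cast; linarith) (by push_cast; linarith)

theorem exists_label_label_of_compl_adj (hf : IsPotential σ f) (hd : HasDenseValues f)
    {a b : C3Vertex} (h : genericC3ᶜ.Adj a b) (v : ZMod 2) :
    ∃ c, pairAtom σ a c = labelAtom v ∧ pairAtom σ c b = labelAtom (v + edgeLabel σ a b) := by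
  obtain ⟨k, d, hk, hd1, hd2, hw⟩ := exists_displacement ((genericC3.compl_adj _ _).1 h).2
  obtain ⟨m, hm⟩ := hd (show max (circleCoord a) (circleCoord b + 3 * k) <
    min (circleCoord a) (circleCoord b + 3 * k) + 1 by
      rcases le_total (circleCoord a) (circleCoord b + 3 * k) with h | h
      · rw [max_eq_right h, min_eq_left h]; linarith
      · rw [max_eq_left h, min_eq_right h]; linarith)
  obtain ⟨c, h1, h2, h3⟩ := hm (v + f a + m)
  have := le_max_left (circleCoord a) (circleCoord b + 3 * k)
  have := le_max_right (circleCoord a) (circleCoord b + 3 * k)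
  have := min_le_left (circleCoord a) (circleCoord b + 3 * k)
  have := min_le_right (circleCoord a) (circleCoord b + 3 * k)
  refine ⟨c, ?_, ?_⟩
  · rw [hf.pairAtom_of_lift m (by linarith) (by linarith) (by linarith), h3]
    congr 1
    linear_combination CharTwo.add_self_eq_zero (f a) + CharTwo.add_self_eq_zero (m : ZMod 2)
  · rw [pairAtom_comm, hf.pairAtom_of_lift (m - k) (by push_cast; intro h0; linarith)
      (by push_cast; linarith) (by push_cast; linarith), h3, hf a b h, hw]
    congr 1
    push_cast
    linear_combination CharTwo.add_self_eq_zero (m : ZMod 2) - CharTwo.add_self_eq_zero (k : ZMod 2)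

theorem exists_label_N_of_adj (hf : IsPotential σ f) (hd : HasDenseValues f) {a b : C3Vertex}
    (h : genericC3.Adj a b) (v : ZMod 2) :
    ∃ c, pairAtom σ a c = labelAtom v ∧ pairAtom σ c b = Atom56.N := by
  obtain ⟨k, hk1, hk2⟩ := exists_lift_of_genericC3_adj h
  obtain ⟨m, hm⟩ := hd (show circleCoord a < circleCoord b + 3 * k - 1 by linarith)
  obtain ⟨c, h1, h2, h3⟩ := hm (v + f a + m)
  refine ⟨c, ?_, pairAtom_eq_N_of_lift (k - m) (by push_cast; linarith) (by push_cast; linarith)⟩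
  rw [hf.pairAtom_of_lift m (by linarith) (by linarith) (by linarith), h3]
  congr 1
  linear_combination CharTwo.add_self_eq_zero (f a) + CharTwo.add_self_eq_zero (m : ZMod 2)

/-- Vertices `a` and `b` that are adjacent in `genericC3` have common neighbours in the complement
on either side. A path through one side together with a path through the other side winds around the
circle once, so the sums of the labels along the two paths differ. -/
theorem exists_label_label_of_adj (hf : IsPotential σ f) (hd : HasDenseValues f) {a b : C3Vertex}
    (h : genericC3.Adj a b) (v w : ZMod 2) :
    ∃ c, pairAtom σ a c = labelAtom v ∧ pairAtom σ c b = labelAtom w := by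
  obtain ⟨k, hk1, hk2⟩ := exists_lift_of_genericC3_adj h
  rcases (by decide : ∀ s t : ZMod 2, s = t ∨ s = t + 1) (v + w) (f a + f b + k) with hs | hs
  · obtain ⟨m, hm⟩ := hd (show circleCoord b + 3 * k - 1 < circleCoord a + 1 by linarith)
    obtain ⟨c, h1, h2, h3⟩ := hm (v + f a + m)
    refine ⟨c, ?_, ?_⟩
    · rw [hf.pairAtom_of_lift m (by linarith) (by linarith) (by linarith), h3]
      congr 1
      linear_combination CharTwo.add_self_eq_zero (f a) + CharTwo.add_self_eq_zero (m : ZMod 2)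
    · rw [hf.pairAtom_of_lift (k - m) (by push_cast; intro h0; linarith) (by push_cast; linarith)
        (by push_cast; linarith), h3]
      congr 1
      push_cast
      linear_combination -hs + CharTwo.add_self_eq_zero v
  · obtain ⟨m, hm⟩ := hd (show circleCoord a + 2 < circleCoord b + 3 * k + 1 by linarith)
    obtain ⟨c, h1, h2, h3⟩ := hm (v + f a + (m - 1))
    refine ⟨c, ?_, ?_⟩
    · rw [hf.pairAtom_of_lift (m - 1) (by push_cast; intro h0; linarith) (by push_cast; linarith)
        (by push_cast; linarith), h3]
      congr 1
      push_cast
      linear_combination CharTwo.add_self_eq_zero (f a) +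
        CharTwo.add_self_eq_zero ((m : ZMod 2) - 1)
    · rw [hf.pairAtom_of_lift (k - m) (by push_cast; intro h0; linarith) (by push_cast; linarith)
        (by push_cast; linarith), h3]
      congr 1
      push_cast
      linear_combination -hs + CharTwo.add_self_eq_zero v -
        CharTwo.add_self_eq_zero (1 : ZMod 2)

/-- Every allowed triple of atoms over a pair `a, b` is realized by some vertex `c`; this is what
composition requires of a representation. -/
theorem exists_pairAtom_eq_of_not_forbidden (hf : IsPotential σ f) (hd : HasDenseValues f)
    (a b : C3Vertex) (x y : Atom56) (h : ¬ Atom56.Forbidden x y (pairAtom σ a b)) :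
    ∃ c, pairAtom σ a c = x ∧ pairAtom σ c b = y := by
  have f1 : ∀ y z, ¬ Atom56.Forbidden Atom56.ident y z → y = z := by decide
  have f2 : ∀ x z, ¬ Atom56.Forbidden x Atom56.ident z → x = z := by decide
  have f3 : ∀ x y, ¬ Atom56.Forbidden x y Atom56.ident → x = y := by decide
  have f4 : ∀ u v w, ¬ Atom56.Forbidden (labelAtom u) (labelAtom v) (labelAtom w) →
    v = u + w := by decide
  have f5 : Atom56.Forbidden Atom56.N Atom56.N Atom56.N := by decide
  have swap : ∀ {x y : Atom56}, (∃ c, pairAtom σ b c = y ∧ pairAtom σ c a = x) →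
      ∃ c, pairAtom σ a c = x ∧ pairAtom σ c b = y := by
    rintro x y ⟨c, h1, h2⟩
    exact ⟨c, by rw [pairAtom_comm, h2], by rw [pairAtom_comm, h1]⟩
  rcases eq_or_ne a b with rfl | hab
  · rw [pairAtom_self] at h
    obtain ⟨c, hc⟩ := exists_pairAtom_eq hf hd a x
    exact ⟨c, hc, by rw [pairAtom_comm, hc]; exact f3 _ _ h⟩
  rcases atom_cases x with rfl | hx
  · exact ⟨a, pairAtom_self σ a, (f1 _ _ h).symm⟩
  rcases atom_cases y with rfl | hy
  · exact ⟨b, (f2 _ _ h).symm, pairAtom_self σ b⟩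
  rcases pairAtom_cases σ hab with ⟨hadj, he⟩ | ⟨hadj, he⟩ <;> rw [he] at h <;>
    rcases hx with rfl | ⟨v, rfl⟩ <;> rcases hy with rfl | ⟨w, rfl⟩
  · exact absurd f5 h
  · exact swap (exists_label_N_of_adj hf hd hadj.symm w)
  · exact exists_label_N_of_adj hf hd hadj v
  · exact exists_label_label_of_adj hf hd hadj v w
  · exact exists_N_N_of_compl_adj hd hadj
  · exact swap (exists_label_N_of_compl_adj hf hd hadj.symm w)
  · exact exists_label_N_of_compl_adj hf hd hadj v
  · rw [f4 _ _ _ h]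
    exact exists_label_label_of_compl_adj hf hd hadj v

theorem isRepresentation_signedGraphStructure (hf : IsPotential σ f) (hd : HasDenseValues f) :
    IsRepresentation (signedGraphStructure σ) where
  interp_bot := rfl
  interp_top := by
    ext q
    rw [Set.mem_iUnion]
    exact ⟨fun h => ⟨⊤, h⟩, fun _ => trivial⟩
  interp_ident := by
    ext q
    exact pairAtom_eq_ident_iff σ
  interp_compl a := by
    ext q
    exact ⟨fun h => ⟨trivial, h⟩, fun h => h.2⟩
  interp_conv a := by
    ext q
    change pairAtom σ q.1 q.2 ∈ a ↔ pairAtom σ q.2 q.1 ∈ a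
    rw [pairAtom_comm]
  interp_sup a b := rfl
  interp_rcomp a b := by
    ext ⟨x, y⟩
    constructor
    · rintro ⟨z, hxz, hzy⟩
      exact ⟨_, hxz, _, hzy, not_forbidden_pairAtom (fun _ _ _ => genericC3_triangle_free)
        hf.isAntiEvenBalancing x z y⟩
    · rintro ⟨u, hu, v, hv, h⟩
      obtain ⟨z, h1, h2⟩ := exists_pairAtom_eq_of_not_forbidden hf hd x y u v h
      refine ⟨z, ?_, ?_⟩
      · change pairAtom σ x z ∈ a
        rwa [h1]
      · change pairAtom σ z y ∈ b
        rwa [h2]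

end Extension

/-! ### Primitive positive definability -/

/-- The relation `R` between an assignment of the free variables and a tuple of elements is defined
by a primitive positive formula. -/
def IsPPDefinable {L : Language} {M α : Type*} (S : L.Structure M) {n : ℕ}
    (R : (α → M) → (Fin n → M) → Prop) : Prop :=
  ∃ φ : L.BoundedFormula α n, IsPrimitivePositive φ ∧ ∀ v xs, R v xs ↔ φ.Realize v xs

namespace IsPPDefinable

variable {L : Language} {M α : Type*} {S : L.Structure M}

theorem inf {n : ℕ} {R R' : (α → M) → (Fin n → M) → Prop} (h : IsPPDefinable S R)
    (h' : IsPPDefinable S R') : IsPPDefinable S fun v xs => R v xs ∧ R' v xs := by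
  obtain ⟨φ, hφ, hR⟩ := h
  obtain ⟨ψ, hψ, hR'⟩ := h'
  exact ⟨φ ⊓ ψ, hφ.inf hψ, fun v xs => by
    simp only [Language.BoundedFormula.realize_inf, hR, hR']⟩

theorem ex {n : ℕ} {R : (α → M) → (Fin (n + 1) → M) → Prop} (h : IsPPDefinable S R) :
    IsPPDefinable S fun v (xs : Fin n → M) => ∃ a, R v (Fin.snoc xs a) := by
  obtain ⟨φ, hφ, hR⟩ := h
  exact ⟨φ.ex, hφ.ex, fun v xs => by simp only [Language.BoundedFormula.realize_ex, hR]⟩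

theorem exists_one {R : (α → M) → M → Prop}
    (h : IsPPDefinable S fun v (xs : Fin 1 → M) => R v (xs 0)) :
    IsPPDefinable S fun v (_ : Fin 0 → M) => ∃ a, R v a := h.ex

theorem exists_two {R : (α → M) → M → M → Prop}
    (h : IsPPDefinable S fun v (xs : Fin 2 → M) => R v (xs 0) (xs 1)) :
    IsPPDefinable S fun v (_ : Fin 0 → M) => ∃ a b, R v a b := h.ex.ex

end IsPPDefinable

section Colourings

variable {V : Type*} {G : SimpleGraph V}

theorem isPPDefinable_pairAtom (σ : Labelling G) {α : Type*} {n : ℕ} (s t : α ⊕ Fin n)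
    (a : Set Atom56) : IsPPDefinable (signedGraphStructure σ)
      fun v xs => pairAtom σ (Sum.elim v xs s) (Sum.elim v xs t) ∈ a :=
  ⟨_, .of_isAtomic (.rel (BinarySymbol.sym a : (binaryLanguage (Set Atom56)).Relations 2)
    ![Language.Term.var s, Language.Term.var t]), fun _ _ => Iff.rfl⟩

/-! ### A primitive positive construction of the triangle -/

/-- A tuple `(p, x₁, x₂, x₃)` in which `x₁, x₂, x₃` are neighbours of `p` is regarded as the triple
of the labels of the edges `p xᵢ`. The condition forces one of these labels to be `1`: if all of
them were `0`, like that of `p w`, then `z` would be related by `N` to both of `x₁, x₂` or to both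
of `x₃, w`, depending on the label of `p z`. -/
def IsColourTuple (σ : Labelling G) (s : Fin 4 → V) : Prop :=
  pairAtom σ (s 0) (s 1) ∈ ({.zero, .one} : Set Atom56) ∧
  pairAtom σ (s 0) (s 2) ∈ ({.zero, .one} : Set Atom56) ∧
  pairAtom σ (s 0) (s 3) ∈ ({.zero, .one} : Set Atom56) ∧
  pairAtom σ (s 1) (s 2) ∈ ({.N} : Set Atom56) ∧
  ∃ w z, pairAtom σ (s 0) w ∈ ({.zero} : Set Atom56) ∧
    pairAtom σ (s 3) w ∈ ({.N} : Set Atom56) ∧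
    pairAtom σ (s 0) z ∈ ({.zero, .one} : Set Atom56) ∧
    pairAtom σ z (s 1) ∈ ({.N, .one} : Set Atom56) ∧
    pairAtom σ z (s 2) ∈ ({.N, .one} : Set Atom56) ∧
    pairAtom σ z (s 3) ∈ ({.ident, .N, .zero} : Set Atom56) ∧
    pairAtom σ z w ∈ ({.ident, .N, .zero} : Set Atom56)

/-- A condition which implies that the edges `p x` and `p y` are not both labelled `1`. -/
def AreSeparated (σ : Labelling G) (p x y : V) : Prop :=
  pairAtom σ x y ∈ ({.N, .one} : Set Atom56) ∧
  ∃ z, pairAtom σ p z ∈ ({.one} : Set Atom56) ∧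
    pairAtom σ z x ∈ ({.N, .one} : Set Atom56) ∧ pairAtom σ z y ∈ ({.N, .one} : Set Atom56)

/-- The edge relation of the constructed graph: two triples of labels, taken at the same vertex,
which do not have a `1` in the same place. -/
def ColourAdj (σ : Labelling G) (s t : Fin 4 → V) : Prop :=
  pairAtom σ (s 0) (t 0) ∈ ({.ident} : Set Atom56) ∧ IsColourTuple σ s ∧ IsColourTuple σ t ∧
    AreSeparated σ (s 0) (s 1) (t 1) ∧ AreSeparated σ (s 0) (s 2) (t 2) ∧
    AreSeparated σ (s 0) (s 3) (t 3)

/-- The graph with edge relation `ColourAdj`. -/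
@[reducible]
def colourStructure (σ : Labelling G) : Language.graph.Structure (Fin 4 → V) where
  funMap f := isEmptyElim f
  RelMap | .adj => fun v => ColourAdj σ (v 0) (v 1)

theorem isPPPower_colourStructure (σ : Labelling G) :
    IsPPPower (signedGraphStructure σ) (colourStructure σ) := by
  have free : ∀ {n : ℕ} (i j : Fin 2) (k l : Fin 4) (a : Set Atom56),
      IsPPDefinable (signedGraphStructure σ) fun (v : Fin 2 × Fin 4 → V) (_ : Fin n → V) =>
        pairAtom σ (v (i, k)) (v (j, l)) ∈ a := fun i j k l a =>
    isPPDefinable_pairAtom σ (Sum.inl (i, k)) (Sum.inl (j, l)) a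
  have right : ∀ {n : ℕ} (i : Fin 2) (k : Fin 4) (m : Fin n) (a : Set Atom56),
      IsPPDefinable (signedGraphStructure σ) fun (v : Fin 2 × Fin 4 → V) (xs : Fin n → V) =>
        pairAtom σ (v (i, k)) (xs m) ∈ a := fun i k m a =>
    isPPDefinable_pairAtom σ (Sum.inl (i, k)) (Sum.inr m) a
  have left : ∀ {n : ℕ} (i : Fin 2) (k : Fin 4) (m : Fin n) (a : Set Atom56),
      IsPPDefinable (signedGraphStructure σ) fun (v : Fin 2 × Fin 4 → V) (xs : Fin n → V) =>
        pairAtom σ (xs m) (v (i, k)) ∈ a := fun i k m a =>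
    isPPDefinable_pairAtom σ (Sum.inr m) (Sum.inl (i, k)) a
  have bound : ∀ {n : ℕ} (m m' : Fin n) (a : Set Atom56),
      IsPPDefinable (signedGraphStructure σ) fun (_ : Fin 2 × Fin 4 → V) (xs : Fin n → V) =>
        pairAtom σ (xs m) (xs m') ∈ a := fun m m' a =>
    isPPDefinable_pairAtom σ (Sum.inr m) (Sum.inr m') a
  have tuple : ∀ i : Fin 2, IsPPDefinable (signedGraphStructure σ)
      fun (v : Fin 2 × Fin 4 → V) (_ : Fin 0 → V) => IsColourTuple σ fun k => v (i, k) := fun i =>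
    (free i i _ _ _).inf <| (free i i _ _ _).inf <| (free i i _ _ _).inf <| (free i i _ _ _).inf <|
      IsPPDefinable.exists_two <| (right i _ _ _).inf <| (right i _ _ _).inf <|
        (right i _ _ _).inf <| (left i _ _ _).inf <| (left i _ _ _).inf <|
          (left i _ _ _).inf <| bound _ _ _
  have separated : ∀ k : Fin 4, IsPPDefinable (signedGraphStructure σ)
      fun (v : Fin 2 × Fin 4 → V) (_ : Fin 0 → V) =>
        AreSeparated σ (v (0, 0)) (v (0, k)) (v (1, k)) := fun k =>
    (free 0 1 _ _ _).inf <| IsPPDefinable.exists_one <|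
      (right 0 _ _ _).inf <| (left 0 _ _ _).inf <| left 1 _ _ _
  rintro _ ⟨⟩
  obtain ⟨φ, hφ, h⟩ := (free 0 1 0 0 {.ident}).inf <| (tuple 0).inf <| (tuple 1).inf <|
    (separated 1).inf <| (separated 2).inf <| separated 3
  exact ⟨φ, hφ, fun v => h (fun q => v q.1 q.2) default⟩

section Soundness

variable {σ : Labelling G}

theorem IsColourTuple.exists_one {s : Fin 4 → V} (h : IsColourTuple σ s)
    (hσ : ∀ x y z, ¬ Atom56.Forbidden (pairAtom σ x y) (pairAtom σ y z) (pairAtom σ x z)) :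
    pairAtom σ (s 0) (s 1) = .one ∨ pairAtom σ (s 0) (s 2) = .one ∨
      pairAtom σ (s 0) (s 3) = .one := by
  obtain ⟨h1, h2, h3, h12, w, z, hw, h3w, hz, hz1, hz2, hz3, hzw⟩ := h
  by_contra! h
  have h1 := h1.resolve_right h.1
  have h2 := h2.resolve_right h.2.1
  have h3 := h3.resolve_right h.2.2
  have f0 : ∀ a, a = Atom56.N ∨ a = Atom56.one → ¬ Atom56.Forbidden .zero a .zero →
      a = Atom56.N := by decide
  have f1 : ∀ a, a = Atom56.ident ∨ a = Atom56.N ∨ a = Atom56.zero →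
      ¬ Atom56.Forbidden .one a .zero → a = Atom56.N := by decide
  have fN : Atom56.Forbidden .N .N .N := by decide
  rcases hz with hz | hz
  · have e1 := f0 _ hz1 (by simpa only [hz, h1] using hσ (s 0) z (s 1))
    have e2 := f0 _ hz2 (by simpa only [hz, h2] using hσ (s 0) z (s 2))
    have := hσ z (s 1) (s 2)
    rw [e1, e2, h12] at this
    exact this fN
  · replace hz : pairAtom σ (s 0) z = .one := hz
    have e3 := f1 _ hz3 (by simpa only [hz, h3] using hσ (s 0) z (s 3))
    have ew := f1 _ hzw (by
      have := hσ (s 0) z w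
      rwa [hz, hw] at this)
    have := hσ z (s 3) w
    rw [e3, ew, h3w] at this
    exact this fN

theorem AreSeparated.not_both_one {p x y : V} (h : AreSeparated σ p x y)
    (hσ : ∀ x y z, ¬ Atom56.Forbidden (pairAtom σ x y) (pairAtom σ y z) (pairAtom σ x z))
    (hx : pairAtom σ p x = .one) : pairAtom σ p y ≠ .one := by
  intro hy
  obtain ⟨hxy, z, hz, hzx, hzy⟩ := h
  have f1 : ∀ a, a = Atom56.N ∨ a = Atom56.one → ¬ Atom56.Forbidden .one a .one →
      a = Atom56.N := by decide
  have fN : Atom56.Forbidden .N .N .N := by decide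
  have e := f1 _ hxy (by simpa only [hx, hy] using hσ p x y)
  have ex := f1 _ hzx (by
    have := hσ p z x
    rwa [hz, hx] at this)
  have ey := f1 _ hzy (by
    have := hσ p z y
    rwa [hz, hy] at this)
  have := hσ z x y
  rw [e, ex, ey] at this
  exact this fN

open Classical in
/-- The colour of a tuple is the first place in which the corresponding triple of labels has a
`1`. -/
theorem exists_colouring
    (hσ : ∀ x y z, ¬ Atom56.Forbidden (pairAtom σ x y) (pairAtom σ y z) (pairAtom σ x z)) :
    ∃ c : (Fin 4 → V) → Fin 3, ∀ s t, ColourAdj σ s t → c s ≠ c t := by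
  refine ⟨fun s => if pairAtom σ (s 0) (s 1) = .one then 0 else
    if pairAtom σ (s 0) (s 2) = .one then 1 else 2, ?_⟩
  rintro s t ⟨hst, hs, ht, h1, h2, h3⟩
  have h0 : s 0 = t 0 := by
    by_contra hne
    unfold pairAtom at hst
    rw [if_neg hne] at hst
    split_ifs at hst <;> cases hst
  have hs := hs.exists_one hσ
  have ht := ht.exists_one hσ
  have h1 := h1.not_both_one hσ
  have h2 := h2.not_both_one hσ
  have h3 := h3.not_both_one hσ
  rw [← h0] at ht
  simp only [← h0]
  split_ifs <;> first | decide | (exfalso; tauto)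

end Soundness

/-- Five vertices suffice for a triangle of the constructed graph: `p` and, for each label, a
neighbour of `p` on either side. -/
theorem exists_triangle {σ : Labelling G} {p : V} {l r : ZMod 2 → V}
    (symm : ∀ x y, pairAtom σ x y = pairAtom σ y x) (hl : ∀ v, pairAtom σ p (l v) = labelAtom v)
    (hr : ∀ v, pairAtom σ p (r v) = labelAtom v) (hlr : ∀ u v, pairAtom σ (l u) (r v) = .N)
    (hll : pairAtom σ (l 0) (l 1) = .one) (hrr : pairAtom σ (r 0) (r 1) = .one) :
    ∃ t : Fin 3 → Fin 4 → V, ∀ i j, i ≠ j → ColourAdj σ (t i) (t j) := by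
  have self : ∀ x, pairAtom σ x x = .ident := fun x => if_pos rfl
  have hl0 : pairAtom σ p (l 0) = .zero := hl 0
  have hl1 : pairAtom σ p (l 1) = .one := hl 1
  have hr0 : pairAtom σ p (r 0) = .zero := hr 0
  have hr1 : pairAtom σ p (r 1) = .one := hr 1
  have hrl : ∀ u v, pairAtom σ (r u) (l v) = .N := fun u v => (symm _ _).trans (hlr v u)
  have hll' : pairAtom σ (l 1) (l 0) = .one := (symm _ _).trans hll
  have hrr' : pairAtom σ (r 1) (r 0) = .one := (symm _ _).trans hrr
  have t0 : IsColourTuple σ ![p, l 1, r 0, l 0] :=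
    ⟨Or.inr hl1, Or.inl hr0, Or.inl hl0, hlr 1 0, r 0, l 0, hr0, hlr 0 0, Or.inl hl0, Or.inr hll,
      Or.inl (hlr 0 0), Or.inl (self _), Or.inr (Or.inl (hlr 0 0))⟩
  have t1 : IsColourTuple σ ![p, l 0, r 1, r 0] :=
    ⟨Or.inl hl0, Or.inr hr1, Or.inl hr0, hlr 0 1, l 0, r 0, hl0, hrl 0 0, Or.inl hr0,
      Or.inl (hrl 0 0), Or.inr hrr, Or.inl (self _), Or.inr (Or.inl (hrl 0 0))⟩
  have t2 : IsColourTuple σ ![p, r 0, l 0, l 1] :=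
    ⟨Or.inl hr0, Or.inl hl0, Or.inr hl1, hrl 0 0, r 0, l 1, hr0, hlr 1 0, Or.inr hl1,
      Or.inl (hlr 1 0), Or.inr hll', Or.inl (self _), Or.inr (Or.inl (hlr 1 0))⟩
  have comm : ∀ {x y}, AreSeparated σ p x y → AreSeparated σ p y x := by
    rintro x y ⟨h, z, hz, hx, hy⟩
    exact ⟨symm x y ▸ h, z, hz, hy, hx⟩
  have sll : AreSeparated σ p (l 0) (l 1) :=
    ⟨Or.inr hll, r 1, hr1, Or.inl (hrl 1 0), Or.inl (hrl 1 1)⟩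
  have srr : AreSeparated σ p (r 0) (r 1) :=
    ⟨Or.inr hrr, l 1, hl1, Or.inl (hlr 1 0), Or.inl (hlr 1 1)⟩
  have slr : ∀ u, AreSeparated σ p (l u) (r 0) := fun u =>
    ⟨Or.inl (hlr u 0), r 1, hr1, Or.inl (hrl 1 u), Or.inr hrr'⟩
  have slr' : AreSeparated σ p (l 0) (r 1) :=
    ⟨Or.inl (hlr 0 1), l 1, hl1, Or.inr hll', Or.inl (hlr 1 1)⟩
  have h01 : ColourAdj σ ![p, l 1, r 0, l 0] ![p, l 0, r 1, r 0] :=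
    ⟨self p, t0, t1, comm sll, srr, slr 0⟩
  have h02 : ColourAdj σ ![p, l 1, r 0, l 0] ![p, r 0, l 0, l 1] :=
    ⟨self p, t0, t2, slr 1, comm (slr 0), sll⟩
  have h12 : ColourAdj σ ![p, l 0, r 1, r 0] ![p, r 0, l 0, l 1] :=
    ⟨self p, t1, t2, slr 0, comm slr', comm (slr 1)⟩
  have h10 : ColourAdj σ ![p, l 0, r 1, r 0] ![p, l 1, r 0, l 0] :=
    ⟨self p, t1, t0, sll, comm srr, comm (slr 0)⟩
  have h20 : ColourAdj σ ![p, r 0, l 0, l 1] ![p, l 1, r 0, l 0] :=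
    ⟨self p, t2, t0, comm (slr 1), slr 0, comm sll⟩
  have h21 : ColourAdj σ ![p, r 0, l 0, l 1] ![p, l 0, r 1, r 0] :=
    ⟨self p, t2, t1, comm (slr 0), slr', slr 1⟩
  refine ⟨![![p, l 1, r 0, l 0], ![p, l 0, r 1, r 0], ![p, r 0, l 0, l 1] ], fun i j hij => ?_⟩
  fin_cases i <;> fin_cases j <;> first | exact absurd rfl hij | assumption

theorem ppConstructs_triangle {σ : Labelling G}
    (hσ : ∀ x y z, ¬ Atom56.Forbidden (pairAtom σ x y) (pairAtom σ y z) (pairAtom σ x z))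
    (h : ∃ t : Fin 3 → Fin 4 → V, ∀ i j, i ≠ j → ColourAdj σ (t i) (t j)) :
    PPConstructs (signedGraphStructure σ) (⊤ : SimpleGraph (Fin 3)).structure := by
  obtain ⟨c, hc⟩ := exists_colouring hσ
  obtain ⟨t, ht⟩ := h
  let _ := colourStructure σ
  let _ := (⊤ : SimpleGraph (Fin 3)).structure
  refine ⟨4, by norm_num, colourStructure σ, isPPPower_colourStructure σ, ⟨⟨c, ?_, ?_⟩⟩,
    ⟨⟨t, ?_, ?_⟩⟩⟩
  · exact fun f => isEmptyElim f
  · rintro _ ⟨⟩ v hv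
    exact hc _ _ hv
  · exact fun f => isEmptyElim f
  · rintro _ ⟨⟩ v hv
    exact ht _ _ hv

end Colourings

theorem exists_colour_triangle {σ : Labelling genericC3ᶜ} {f : C3Vertex → ZMod 2}
    (hf : IsPotential σ f) (hd : HasDenseValues f) (p : C3Vertex) :
    ∃ t : Fin 3 → Fin 4 → C3Vertex, ∀ i j, i ≠ j → ColourAdj σ (t i) (t j) := by
  -- Common neighbours of `p` in two intervals whose points have distance between `1` and `2`.
  obtain ⟨m, hm⟩ := hd (show circleCoord p - 1 < circleCoord p - 1 / 2 by linarith)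
  obtain ⟨n, hn⟩ := hd (show circleCoord p + 1 / 2 < circleCoord p + 1 by linarith)
  choose l hl hl' hfl using fun v => hm (v + f p + m)
  choose r hr hr' hfr using fun v => hn (v + f p + n)
  have same : ∀ x y, f x + f y = 1 → |circleCoord y - circleCoord x| < 1 →
      pairAtom σ x y = .one := by
    intro x y hxy h
    rw [hf.pairAtom_of_lift 0, Int.cast_zero, add_zero, hxy]
    · rfl
    · rw [Int.cast_zero, mul_zero, add_zero]
      intro h0
      rw [circleCoord_injective (sub_eq_zero.1 h0), CharTwo.add_self_eq_zero] at hxy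
      exact zero_ne_one hxy
    · simpa using (abs_lt.1 h).1
    · simpa using (abs_lt.1 h).2
  refine exists_triangle (p := p) (l := l) (r := r) (pairAtom_comm σ) ?_ ?_ ?_ ?_ ?_
  · intro v
    have := hl v
    have := hl' v
    rw [hf.pairAtom_of_lift m (by linarith) (by linarith) (by linarith), hfl]
    congr 1
    linear_combination CharTwo.add_self_eq_zero (f p) + CharTwo.add_self_eq_zero (m : ZMod 2)
  · intro v
    have := hr v
    have := hr' v
    rw [hf.pairAtom_of_lift n (by linarith) (by linarith) (by linarith), hfr]
    congr 1
    linear_combination CharTwo.add_self_eq_zero (f p) + CharTwo.add_self_eq_zero (n : ZMod 2)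
  · intro u v
    have := hl u
    have := hl' u
    have := hr v
    have := hr' v
    exact pairAtom_eq_N_of_lift (n - m) (by push_cast; linarith) (by push_cast; linarith)
  · refine same _ _ ?_ (abs_lt.2 ⟨by linarith [hl 1, hl' 0], by linarith [hl 0, hl' 1]⟩)
    rw [hfl, hfl]
    linear_combination CharTwo.add_self_eq_zero (f p) + CharTwo.add_self_eq_zero (m : ZMod 2)
  · refine same _ _ ?_ (abs_lt.2 ⟨by linarith [hr 1, hr' 0], by linarith [hr 0, hr' 1]⟩)
    rw [hfr, hfr]
    linear_combination CharTwo.add_self_eq_zero (f p) + CharTwo.add_self_eq_zero (n : ZMod 2)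

theorem mainTheorem7 (C₀ C₁ : Set C3Vertex) (hC : IsCompl C₀ C₁) (h₀ : Dense C₀) (h₁ : Dense C₁)
    (p : SimpleGraph.cycleGraph 5 ↪g genericC3ᶜ) (e : ZMod 2)
    (he : e = C₁.indicator 1 (p 0) ∨ e = C₁.indicator 1 (p 1)) :
    (∃! σ : Labelling genericC3ᶜ, IsAntiEvenBalancing σ ∧ ExtendsTreeLabelling C₁ p e σ) ∧
    ∀ σ : Labelling genericC3ᶜ, IsAntiEvenBalancing σ → ExtendsTreeLabelling C₁ p e σ →
      IsRepresentation (signedGraphStructure σ) ∧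
      PPConstructs (signedGraphStructure σ) (⊤ : SimpleGraph (Fin 3)).structure := by
  refine ⟨existsUnique_labelling C₁ p e, fun σ hσ hext => ?_⟩
  obtain ⟨f, hf⟩ := hσ.exists_isPotential p
  have hd : HasDenseValues f := fun _ _ => exists_lifted_potential_eq
    fun hlu hl hu v => exists_potential_eq_of_interval hC h₀ h₁ hext hf hlu hl hu v
  exact ⟨isRepresentation_signedGraphStructure hf hd,
    ppConstructs_triangle (not_forbidden_pairAtom (fun _ _ _ => genericC3_triangle_free) hσ)
      (exists_colour_triangle hf hd (p 0))⟩
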